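/- **Theorem 5 (monotonicity of $\Upsilon_K$).** *Channel.* Fix a law of complex fading coefficients that has no atoms, is bounded away from $0$ and $\infty$, and satisfies $\mathbb E|h|^2=1$. For every user index $p$ and block length $n$ fix a law of an a.s. invertible random complex $n\times n$ matrix $\mathbf F_p$ (deterministic matrices allowed), with $\frac1n\operatorname{tr}(\mathbf F_p\mathbf F_p^{\mathrm H})\to1$ in probability as $n\to\infty$. In a block of $n$ slots the $K$-user interference channel is $$Y^{[p]}=\sum_{q\ne p}\mathbf H^{[pq]}X^{[q]}+\mathbf F_p\mathbf H^{[pp]}X^{[p]}+Z^{[p]},\qquad p=1,\dots,K,$$ where $\mathbf H^{[pq]}=\operatorname{diag}(h^{[pq]}_1,\dots,h^{[pq]}_n)$, all $h^{[pq]}_j$ are i.i.d. with the given law, the $\mathbf F_p$ are independent with the given laws, the noise $Z^{[p]}$ is i.i.d. circularly symmetric complex Gaussian of variance $1$, and coefficients, matrices and noise are independent. The $(K-1)$-user channel is the one with the same laws and the users $1,\dots,K-1$. *Channel state information (CSI).* A CSI pattern gives, for each $n$, sets $U^{[pq]}\subseteq\{1,\dots,n\}$: all transmitters and receivers know $h^{[pq]}_j$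 (for the whole block) for $j\notin U^{[pq]}$, and not for $j\in U^{[pq]}$. Receiver $p$ moreover knows $\mathbf F_p\mathbf H^{[pp]}$. The pattern has perfect-CSI fraction $\upsilon$ if $1-\frac1n\bigl|\bigcup_{p\neq q}U^{[pq]}\bigr|\to\upsilon$ as $n\to\infty$. *Degrees of freedom (DoF).* Let $\mathcal C(\rho)$ be the capacity region (closure of the achievable rate tuples, in bits per slot, with vanishing average error probability) under total transmit power $\rho$. The DoF region consists of all $d\in\mathbb R_{\ge0}^K$ such that $\sum_q w_qd_q\le\limsup_{\rho\to\infty}\sup_{R\in\mathcal C(\rho)}\frac{\sum_q w_qR_q}{\log_2\rho}$ for all $w\in\mathbb R_{\ge0}^K$. The maximum DoF is achieved if the region contains some $d$ with $\sum_q d_q=K/2$. *Statement.* Let $\Upsilon_K$ be the minimum (infimum; $+\infty$ if there is none) of the $\upsilon\in[0,1]$ such that the maximum DoF $K/2$ of the $K$-user channel is achieved under every CSI pattern with perfect-CSI fraction $\upsilon$. Then for every $K\ge3$, $$\Upsilon_K\ \ge\ \Upsilon_{K-1}.$$ -/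

import Mathlib

open MeasureTheory ProbabilityTheory Filter Topology

noncomputable section

namespace InterferenceChannel

/-- Complex matrices carry the product (Borel) sigma-algebra of their entries. -/
instance matrixMeasurableSpace (n : ℕ) : MeasurableSpace (Matrix (Fin n) (Fin n) ℂ) :=
  inferInstanceAs (MeasurableSpace (Fin n → Fin n → ℂ))

/-- The statistical description of the links of an interference channel, for any number of users.
`fading` is the common law of the i.i.d. coefficients `h_j^{[pq]}`; `direct p n` is the law of the
`n × n` matrix `F_p` (memory, permutation, ...) that acts on the direct link of user `p` over a
block of `n` time slots (a Dirac mass if `F_p` is deterministic). -/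
structure ChannelLaw where
  fading : Measure ℂ
  fading_prob : IsProbabilityMeasure fading
  /-- the coefficients are drawn from a continuous distribution -/
  fading_noAtoms : NullSingletonClass fading
  /-- the coefficients are bounded away from zero and from infinity -/
  fading_bounded : ∃ a b : ℝ, 0 < a ∧ ∀ᵐ h ∂fading, a ≤ ‖h‖ ∧ ‖h‖ ≤ b
  /-- normalization of the mean power gain of a coefficient -/
  fading_secondMoment : ∫ h, ‖h‖ ^ 2 ∂fading = 1
  direct : ℕ → (n : ℕ) → Measure (Matrix (Fin n) (Fin n) ℂ)
  direct_prob : ∀ p n, IsProbabilityMeasure (direct p n)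
  direct_fullRank : ∀ p n, ∀ᵐ F ∂(direct p n), IsUnit F.det
  /-- `tr (F_p F_pᴴ) / n → 1` (in probability) as the block length `n` tends to infinity -/
  direct_trace : ∀ p, ∀ ε : ℝ, 0 < ε →
    Tendsto (fun n : ℕ => direct p n {F | ε ≤ |(F * F.conjTranspose).trace.re / n - 1|})
      atTop (𝓝 0)

attribute [instance] ChannelLaw.fading_prob ChannelLaw.direct_prob

/-- The law of a circularly symmetric complex Gaussian variable of mean `0` and variance `1`. -/
def noiseLaw : Measure ℂ :=
  ((gaussianReal 0 (1 / 2)).prod (gaussianReal 0 (1 / 2))).map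
    (fun z : ℝ × ℝ => (⟨z.1, z.2⟩ : ℂ))

/-- The fading coefficients over a block: `h p q j` is the coefficient from transmitter `q` to
receiver `p` in slot `j`. -/
abbrev Fading (K n : ℕ) : Type := Fin K → Fin K → Fin n → ℂ

/-- All the randomness of the channel over a block: the fading coefficients, the matrices `F_p`,
and the additive noise at the receivers. -/
abbrev ChannelState (K n : ℕ) : Type :=
  Fading K n × (Fin K → Matrix (Fin n) (Fin n) ℂ) × (Fin K → Fin n → ℂ)

/-- The joint law of the channel state of the `K`-user channel: everything is independent. -/
def ChannelLaw.stateLaw (L : ChannelLaw) (K n : ℕ) : Measure (ChannelState K n) :=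
  (Measure.pi fun _ : Fin K => Measure.pi fun _ : Fin K => Measure.pi fun _ : Fin n =>
      L.fading).prod
    ((Measure.pi fun p : Fin K => L.direct p n).prod
      (Measure.pi fun _ : Fin K => Measure.pi fun _ : Fin n => noiseLaw))

/-- A pattern of channel state information: in a block of `n` slots, `U n p q` is the set of the
slots in which the coefficient from transmitter `q` to receiver `p` is unknown. -/
abbrev CSIPattern (K : ℕ) : Type := (n : ℕ) → Fin K → Fin K → Finset (Fin n)

/-- The fraction `1 - |⋃_{p ≠ q} U^{[pq]}| / n` of the slots of a block in which all the cross
coefficients are known. -/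
def perfectFraction {K : ℕ} (U : CSIPattern K) (n : ℕ) : ℝ :=
  1 - ((Finset.univ.filter fun j : Fin n => ∃ p q : Fin K, p ≠ q ∧ j ∈ U n p q).card : ℝ) / n

/-- The fraction of perfect slots of the pattern `U` is `υ`, asymptotically in the block length. -/
def HasPerfectFraction {K : ℕ} (U : CSIPattern K) (υ : ℝ) : Prop :=
  Tendsto (perfectFraction U) atTop (𝓝 υ)

/-- The coefficients known to all transmitters and receivers. The unknown ones are replaced by
`0`; as the pattern is fixed, this array carries exactly the information of the known ones. -/
def knownCSI {K n : ℕ} (U : Fin K → Fin K → Finset (Fin n)) (h : Fading K n) : Fading K n :=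
  fun p q j => if j ∈ U p q then 0 else h p q j

/-- The direct channel matrix `F_p H^{[pp]}` of user `p`. -/
def directMatrix {K n : ℕ} (h : Fading K n) (F : Fin K → Matrix (Fin n) (Fin n) ℂ) (p : Fin K) :
    Matrix (Fin n) (Fin n) ℂ :=
  F p * Matrix.diagonal (h p p)

/-- The signal at receiver `p` when transmitter `q` sends the block `x q`. -/
def received {K n : ℕ} (s : ChannelState K n) (x : Fin K → Fin n → ℂ) (p : Fin K) : Fin n → ℂ :=
  fun j => (∑ q ∈ Finset.univ.erase p, s.1 p q j * x q j)
    + (directMatrix s.1 s.2.1 p).mulVec (x p) j + s.2.2 p j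

/-- A code of block length `n` with `N q` messages for user `q`. Transmitter `q` knows its own
message and the known coefficients; receiver `p` knows its received block, the known coefficients,
and its own direct channel matrix. -/
structure Code (K n : ℕ) (N : Fin K → ℕ) where
  enc : (q : Fin K) → Fin (N q) → Fading K n → Fin n → ℂ
  dec : (p : Fin K) → (Fin n → ℂ) × Fading K n × Matrix (Fin n) (Fin n) ℂ → Fin (N p)
  enc_measurable : ∀ q m, Measurable (enc q m)
  dec_measurable : ∀ p, Measurable (dec p)

/-- The total power across all transmitters is at most `ρ`. -/
def Code.HasPower {K n : ℕ} {N : Fin K → ℕ} (c : Code K n N) (ρ : ℝ) : Prop :=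
  ∀ (m : (q : Fin K) → Fin (N q)) (θ : Fading K n),
    ∑ q, ∑ j, ‖c.enc q (m q) θ j‖ ^ 2 ≤ n * ρ

/-- The event that some receiver does not recover its message, when `m` is sent. -/
def Code.errorEvent {K n : ℕ} {N : Fin K → ℕ} (c : Code K n N)
    (U : Fin K → Fin K → Finset (Fin n)) (m : (q : Fin K) → Fin (N q)) :
    Set (ChannelState K n) :=
  {s | ∃ p, c.dec p (received s (fun q => c.enc q (m q) (knownCSI U s.1)) p, knownCSI U s.1,
    directMatrix s.1 s.2.1 p) ≠ m p}

/-- The probability of error, for independent and uniformly distributed messages. -/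
def Code.errorProb {K n : ℕ} {N : Fin K → ℕ} (c : Code K n N) (L : ChannelLaw)
    (U : Fin K → Fin K → Finset (Fin n)) : ℝ :=
  (∑ m : (q : Fin K) → Fin (N q), (L.stateLaw K n).real (c.errorEvent U m)) / ∏ q, (N q : ℝ)

/-- The rates `R` (in bits per slot) are achievable with total power `ρ`. -/
def ChannelLaw.IsAchievable (L : ChannelLaw) {K : ℕ} (U : CSIPattern K) (ρ : ℝ)
    (R : Fin K → ℝ) : Prop :=
  (∀ q, 0 ≤ R q) ∧ ∀ ε : ℝ, 0 < ε → ∀ᶠ n : ℕ in atTop,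
    ∃ (N : Fin K → ℕ) (c : Code K n N), (∀ q, (2 : ℝ) ^ ((n : ℝ) * R q) ≤ N q) ∧
      c.HasPower ρ ∧ c.errorProb L (U n) ≤ ε

/-- The capacity region with total power `ρ`. -/
def ChannelLaw.capacityRegion (L : ChannelLaw) {K : ℕ} (U : CSIPattern K) (ρ : ℝ) :
    Set (Fin K → ℝ) :=
  closure {R | L.IsAchievable U ρ R}

/-- The degrees of freedom region. -/
def ChannelLaw.dofRegion (L : ChannelLaw) {K : ℕ} (U : CSIPattern K) : Set (Fin K → ℝ) :=
  {d | (∀ q, 0 ≤ d q) ∧ ∀ w : Fin K → ℝ, (∀ q, 0 ≤ w q) →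
    ((∑ q, w q * d q : ℝ) : EReal) ≤
      limsup (fun ρ : ℝ => ⨆ R ∈ L.capacityRegion U ρ,
        (((∑ q, w q * R q) / Real.logb 2 ρ : ℝ) : EReal)) atTop}

/-- The maximum number `K / 2` of (sum) degrees of freedom is achieved. -/
def ChannelLaw.AchievesMaxDoF (L : ChannelLaw) {K : ℕ} (U : CSIPattern K) : Prop :=
  ∃ d ∈ L.dofRegion U, ∑ q, d q = (K : ℝ) / 2

/-- The fractions `υ` such that perfect channel state information in a fraction `υ` of the time is
enough to achieve the maximum degrees of freedom of the `K`-user channel, whatever the pattern. -/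
def ChannelLaw.sufficientFractions (L : ChannelLaw) (K : ℕ) : Set ℝ :=
  {υ | υ ∈ Set.Icc (0 : ℝ) 1 ∧ ∀ U : CSIPattern K, HasPerfectFraction U υ → L.AchievesMaxDoF U}

/-- `Υ_K`, the minimum (infimum) of the sufficient fractions. It is `⊤` if there is none, and an
element of `[0, 1]` otherwise. -/
def ChannelLaw.minCSIFraction (L : ChannelLaw) (K : ℕ) : EReal :=
  sInf ((fun υ : ℝ => (υ : EReal)) '' L.sufficientFractions K)

end InterferenceChannel

end

/-!
In the two-user channel `d₁ + d₂ ≤ 1`, by a packing argument. Once the first receiver has decoded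
its own message, it is left with the interference plus noise, that is, with a neighbourhood of the
input of the other user. The second receiver decodes its message from a noisy linear image of that
input, so at most `C ^ n` of its messages are compatible with such a neighbourhood. Hence the noise
balls around the noiseless outputs of the first receiver overlap at most `C ^ n` times; as they lie
in an ellipsoid of volume at most `(C ρ) ^ n`, there are at most `(C' ρ) ^ n` pairs of messages.

Revealing the messages of some users, and the coefficients of all links that involve them, turns a
code for all users into one for the remaining users. Hence the DoF region of a channel restricts to
that of any subchannel. In particular any two users have at most one DoF together, and for `3 ≤ K`
this forces `d = (1/2, …, 1/2)` whenever the sum is `K / 2`. The restriction of this point to `M`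
users has sum `M / 2`. A pattern for `M` users extends to one for `K` users with the same fraction
of perfect slots, so a fraction that suffices for `K` users suffices for `M` users.
-/

noncomputable section

namespace InterferenceChannel

open Matrix

open scoped ComplexOrder MatrixOrder Pointwise

section Energy

variable {ι : Type*} [Fintype ι]

/-- The energy of a block of complex symbols: the square of its Euclidean norm, which the sup norm
on `ι → ℂ` does not provide. -/
def energy (x : ι → ℂ) : ℝ := ∑ j, ‖x j‖ ^ 2

/-- The blocks of energy at most `r`: the closed Euclidean ball of radius `√r` about `0`. -/
def energyBall (r : ℝ) : Set (ι → ℂ) := {x | energy x ≤ r}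

@[simp]
lemma mem_energyBall {r : ℝ} {x : ι → ℂ} : x ∈ energyBall r ↔ energy x ≤ r := Iff.rfl

lemma energy_neg (x : ι → ℂ) : energy (-x) = energy x := by
  simp only [energy, Pi.neg_apply, norm_neg]

lemma energy_add_le (x y : ι → ℂ) : energy (x + y) ≤ 2 * energy x + 2 * energy y := by
  simp only [energy, Finset.mul_sum, ← Finset.sum_add_distrib]
  refine Finset.sum_le_sum fun j _ => ?_
  calc ‖x j + y j‖ ^ 2 ≤ (‖x j‖ + ‖y j‖) ^ 2 := by gcongr; exact norm_add_le _ _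
    _ ≤ 2 * ‖x j‖ ^ 2 + 2 * ‖y j‖ ^ 2 := by rw [← mul_add]; exact add_sq_le

lemma energy_mul_le {β : ℝ} {d : ι → ℂ} (hd : ∀ j, ‖d j‖ ≤ β) (x : ι → ℂ) :
    energy (d * x) ≤ β ^ 2 * energy x := by
  simp only [energy, Finset.mul_sum]
  refine Finset.sum_le_sum fun j _ => ?_
  rw [Pi.mul_apply, norm_mul, mul_pow]
  gcongr
  exact hd j

@[fun_prop]
lemma measurable_energy : Measurable (energy : (ι → ℂ) → ℝ) := by
  unfold energy
  fun_prop

lemma measurableSet_energyBall (r : ℝ) : MeasurableSet (energyBall r : Set (ι → ℂ)) :=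
  measurableSet_le measurable_energy measurable_const

lemma volume_energyBall [Nonempty ι] {r : ℝ} (hr : 0 ≤ r) :
    volume (energyBall r : Set (ι → ℂ)) =
      ENNReal.ofReal ((Real.pi * r) ^ Fintype.card ι / (Fintype.card ι).factorial) := by
  have hball : (energyBall r : Set (ι → ℂ)) =
      {x | (∑ i, ‖x i‖ ^ (2 : ℝ)) ^ (1 / (2 : ℝ)) ≤ √r} := by
    ext x
    simp only [mem_energyBall, energy, Set.mem_ofPred_eq, Real.rpow_two, ← Real.sqrt_eq_rpow]
    exact (Real.sqrt_le_sqrt_iff hr).symm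
  rw [hball, Complex.volume_sum_rpow_le ι one_le_two, ← ENNReal.ofReal_pow (Real.sqrt_nonneg r),
    ← ENNReal.ofReal_mul (by positivity), pow_mul, Real.sq_sqrt hr, div_self two_ne_zero,
    one_add_one_eq_two, Real.Gamma_two, mul_div_cancel_left₀ _ two_ne_zero,
    Real.Gamma_nat_eq_factorial, mul_one, mul_pow]
  ring_nf

lemma volume_energyBall_mul_card_le {R : ℝ} (hR : 0 ≤ R) :
    volume (energyBall (R * Fintype.card ι) : Set (ι → ℂ)) ≤
      ENNReal.ofReal ((Real.pi * Real.exp 1 * R) ^ Fintype.card ι) := by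
  cases isEmpty_or_nonempty ι
  · rw [Fintype.card_eq_zero, pow_zero, ENNReal.ofReal_one]
    exact (measure_mono (Set.subset_univ _)).trans (by simp [volume_pi])
  rw [volume_energyBall (by positivity)]
  refine ENNReal.ofReal_le_ofReal ?_
  have hfac := Real.pow_div_factorial_le_exp (Fintype.card ι : ℝ) (by positivity)
    (Fintype.card ι)
  calc (Real.pi * (R * Fintype.card ι)) ^ Fintype.card ι / (Fintype.card ι).factorial
      = (Real.pi * R) ^ Fintype.card ι *
          ((Fintype.card ι : ℝ) ^ Fintype.card ι / (Fintype.card ι).factorial) := by ring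
    _ ≤ (Real.pi * R) ^ Fintype.card ι * Real.exp (Fintype.card ι) := by gcongr
    _ = (Real.pi * Real.exp 1 * R) ^ Fintype.card ι := by
      rw [← Real.exp_one_pow, ← mul_pow]; ring

end Energy

section Noise

lemma measure_pi_mono {ι : Type*} [Fintype ι] {α : ι → Type*} [∀ i, MeasurableSpace (α i)]
    {μ ν : ∀ i, Measure (α i)} (h : ∀ i, μ i ≤ ν i) : Measure.pi μ ≤ Measure.pi ν := by
  refine Measure.le_iff.2 fun s hs => ?_
  rw [Measure.pi, Measure.pi, toMeasure_apply _ _ hs, toMeasure_apply _ _ hs]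
  refine OuterMeasure.le_pi.2 (fun t _ => ?_) s
  exact (OuterMeasure.pi_pi_le _ t).trans (Finset.prod_le_prod' fun i _ => h i (t i))

lemma measurePreserving_noiseLaw :
    MeasurePreserving Complex.measurableEquivRealProd.symm
      ((gaussianReal 0 (1 / 2)).prod (gaussianReal 0 (1 / 2))) noiseLaw :=
  ⟨Complex.measurableEquivRealProd.symm.measurable, rfl⟩

instance isProbabilityMeasure_noiseLaw : IsProbabilityMeasure noiseLaw :=
  Measure.isProbabilityMeasure_map measurePreserving_noiseLaw.aemeasurable

lemma gaussianReal_half_le_volume : gaussianReal 0 (1 / 2) ≤ volume := by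
  rw [gaussianReal_of_var_ne_zero _ (by norm_num)]
  conv_rhs => rw [← withDensity_one (μ := (volume : Measure ℝ))]
  refine withDensity_mono (Eventually.of_forall fun x => ?_)
  rw [gaussianPDF, Pi.one_apply, ENNReal.ofReal_le_one, gaussianPDFReal]
  refine mul_le_one₀ (inv_le_one_of_one_le₀ (Real.one_le_sqrt.2 ?_)) (Real.exp_nonneg _)
    (Real.exp_le_one_iff.2 ?_)
  · push_cast
    linarith [Real.pi_gt_three]
  · exact div_nonpos_of_nonpos_of_nonneg (neg_nonpos.2 (sq_nonneg _)) (by positivity)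

lemma noiseLaw_le_volume : noiseLaw ≤ volume := by
  rw [← Complex.volume_preserving_equiv_real_prod.symm.map_eq, ← measurePreserving_noiseLaw.map_eq]
  exact Measure.map_mono
    (Measure.prod_mono gaussianReal_half_le_volume gaussianReal_half_le_volume)
    Complex.measurableEquivRealProd.symm.measurable

lemma integrable_sq_gaussianReal (v : NNReal) :
    Integrable (fun x : ℝ => x ^ 2) (gaussianReal 0 v) :=
  (memLp_id_gaussianReal' 2 (by norm_num)).integrable_sq

lemma integral_sq_gaussianReal (v : NNReal) : ∫ x, x ^ 2 ∂(gaussianReal 0 v) = v := by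
  have h := variance_id_gaussianReal (μ := 0) (v := v)
  rwa [variance_of_integral_eq_zero aemeasurable_id integral_id_gaussianReal] at h

lemma norm_sq_measurableEquivRealProd_symm (z : ℝ × ℝ) :
    ‖Complex.measurableEquivRealProd.symm z‖ ^ 2 = z.1 ^ 2 + z.2 ^ 2 := by
  rw [Complex.sq_norm, Complex.normSq_apply]
  simp only [Complex.measurableEquivRealProd_symm_apply]
  ring

lemma integrable_norm_sq_noiseLaw : Integrable (fun z : ℂ => ‖z‖ ^ 2) noiseLaw := by
  rw [← measurePreserving_noiseLaw.integrable_comp_emb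
    (MeasurableEquiv.measurableEmbedding _)]
  simp only [Function.comp_def, norm_sq_measurableEquivRealProd_symm]
  exact (integrable_sq_gaussianReal _).comp_fst _ |>.add ((integrable_sq_gaussianReal _).comp_snd _)

lemma integral_norm_sq_noiseLaw : ∫ z, ‖z‖ ^ 2 ∂noiseLaw = 1 := by
  rw [← measurePreserving_noiseLaw.integral_comp' (g := fun z : ℂ => ‖z‖ ^ 2)]
  simp only [norm_sq_measurableEquivRealProd_symm]
  rw [integral_add ((integrable_sq_gaussianReal _).comp_fst _)
    ((integrable_sq_gaussianReal _).comp_snd _)]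
  simp only [integral_fun_fst (fun x : ℝ => x ^ 2), integral_fun_snd (fun x : ℝ => x ^ 2),
    integral_sq_gaussianReal]
  norm_num

/-- The law of the noise at one receiver over a block of length `n`. -/
def blockNoise (n : ℕ) : Measure (Fin n → ℂ) := Measure.pi fun _ => noiseLaw

instance isProbabilityMeasure_blockNoise (n : ℕ) : IsProbabilityMeasure (blockNoise n) :=
  inferInstanceAs (IsProbabilityMeasure (Measure.pi fun _ => noiseLaw))

lemma blockNoise_le_volume (n : ℕ) : blockNoise n ≤ volume :=
  measure_pi_mono fun _ => noiseLaw_le_volume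

lemma integrable_norm_sq_blockNoise {n : ℕ} (j : Fin n) :
    Integrable (fun z : Fin n → ℂ => ‖z j‖ ^ 2) (blockNoise n) :=
  (measurePreserving_eval (fun _ : Fin n => noiseLaw) j).integrable_comp_of_integrable
    integrable_norm_sq_noiseLaw

lemma integral_energy_blockNoise (n : ℕ) : ∫ z, energy z ∂(blockNoise n) = n := by
  have hcoord (j : Fin n) : ∫ z, ‖z j‖ ^ 2 ∂(blockNoise n) = 1 :=
    (integral_comp_eval (μ := fun _ : Fin n => noiseLaw)
      integrable_norm_sq_noiseLaw.aestronglyMeasurable).trans integral_norm_sq_noiseLaw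
  simp only [energy]
  rw [integral_finsetSum _ fun j _ => integrable_norm_sq_blockNoise j]
  simp only [hcoord, Finset.sum_const, Finset.card_univ, Fintype.card_fin, nsmul_eq_mul, mul_one]

lemma blockNoise_compl_energyBall_le {R : ℝ} (hR : 0 < R) (n : ℕ) :
    (blockNoise n).real (energyBall (R * n))ᶜ ≤ R⁻¹ := by
  rcases n.eq_zero_or_pos with rfl | hn
  · have hball : (energyBall (R * (0 : ℕ)) : Set (Fin 0 → ℂ)) = Set.univ := by
      ext; simp [energy]
    simp only [hball, Set.compl_univ, measureReal_empty]
    positivity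
  have hmarkov := mul_meas_ge_le_integral_of_nonneg (μ := blockNoise n) (f := energy)
    (Eventually.of_forall fun z => Finset.sum_nonneg fun j _ => sq_nonneg ‖z j‖)
    (integrable_finsetSum _ fun j _ => integrable_norm_sq_blockNoise j) (R * n)
  rw [integral_energy_blockNoise] at hmarkov
  have hsub : (energyBall (R * n))ᶜ ⊆ {z : Fin n → ℂ | R * n ≤ energy z} :=
    fun z (hz : ¬ energy z ≤ R * n) => (not_le.1 hz).le
  refine (measureReal_mono hsub).trans ?_
  rw [← one_div, le_div_iff₀ hR]
  exact le_of_mul_le_mul_left (by linarith) (Nat.cast_pos.2 hn : (0 : ℝ) < n)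

end Noise

section Matrices

variable {ι : Type*} [Fintype ι]

lemma volume_image_mulVec [DecidableEq ι] (A : Matrix ι ι ℂ) (s : Set (ι → ℂ)) :
    volume ((A *ᵥ ·) '' s) = ENNReal.ofReal (‖A.det‖ ^ 2) * volume s := by
  have h := Measure.addHaar_image_linearMap (volume : Measure (ι → ℂ))
    ((Matrix.mulVecLin A).restrictScalars ℝ) s
  have hdet : LinearMap.det (Matrix.mulVecLin A) = A.det := LinearMap.det_toLin' A
  rwa [LinearMap.det_restrictScalars, hdet, Algebra.norm_complex_apply,
    Complex.normSq_eq_norm_sq, abs_of_nonneg (by positivity)] at h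

lemma norm_det_le_exp_trace [DecidableEq ι] {P : Matrix ι ι ℂ} (hP : P.PosSemidef) :
    ‖P.det‖ ≤ Real.exp (P.trace.re - Fintype.card ι) := by
  set ev := hP.isHermitian.eigenvalues with hev
  have htrace : P.trace.re - Fintype.card ι = ∑ i, (ev i - 1) := by
    simp [hP.isHermitian.trace_eq_sum_eigenvalues, hev, Finset.sum_sub_distrib]
  rw [htrace, Real.exp_sum, hP.isHermitian.det_eq_prod_eigenvalues, norm_prod]
  refine Finset.prod_le_prod (fun _ _ => norm_nonneg _) fun i _ => ?_
  calc ‖(ev i : ℂ)‖ = ev i := by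
        rw [Complex.norm_real, Real.norm_of_nonneg (hP.eigenvalues_nonneg i)]
    _ ≤ Real.exp (ev i - 1) := by linarith [Real.add_one_le_exp (ev i - 1)]

lemma energy_eq_re_dotProduct (x : ι → ℂ) : energy x = (star x ⬝ᵥ x).re := by
  simp only [energy, dotProduct, Complex.re_sum, Pi.star_apply, RCLike.star_def]
  exact Finset.sum_congr rfl fun j _ => by
    rw [← Complex.normSq_eq_conj_mul_self, Complex.ofReal_re, Complex.sq_norm]

lemma two_mul_re_dotProduct_le (x y : ι → ℂ) :
    2 * (star x ⬝ᵥ y).re ≤ energy x + energy y := by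
  simp only [energy, dotProduct, Complex.re_sum, Pi.star_apply, Finset.mul_sum,
    ← Finset.sum_add_distrib]
  refine Finset.sum_le_sum fun j _ => ?_
  have hre : (star (x j) * y j).re ≤ ‖x j‖ * ‖y j‖ :=
    (Complex.re_le_norm _).trans_eq (by rw [norm_mul, norm_star])
  linarith [two_mul_le_add_sq ‖x j‖ ‖y j‖]

lemma trace_mul_conjTranspose_re (A : Matrix ι ι ℂ) :
    (A * Aᴴ).trace.re = ∑ i, ∑ j, ‖A i j‖ ^ 2 := by
  simp only [Matrix.trace, Matrix.diag_apply, Matrix.mul_apply, Matrix.conjTranspose_apply,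
    RCLike.star_def, Complex.mul_conj, ← Complex.ofReal_sum, Complex.ofReal_re,
    Complex.normSq_eq_norm_sq]

lemma trace_mul_diagonal_le [DecidableEq ι] (A : Matrix ι ι ℂ) {d : ι → ℂ} {c : ℝ}
    (hd : ∀ j, ‖d j‖ ≤ c) :
    (A * diagonal d * (A * diagonal d)ᴴ).trace.re ≤ c ^ 2 * (A * Aᴴ).trace.re := by
  simp only [trace_mul_conjTranspose_re, Finset.mul_sum, Matrix.mul_diagonal, norm_mul, mul_pow]
  refine Finset.sum_le_sum fun i _ => Finset.sum_le_sum fun j _ => ?_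
  rw [mul_comm]
  gcongr
  exact hd j

/-- The vectors `M u + v` with `u` and `v` of energy at most `r`: what a receiver may see of an
input and a noise of bounded energies behind the channel matrix `M`. -/
def noisyImage (M : Matrix ι ι ℂ) (r : ℝ) : Set (ι → ℂ) :=
  (M *ᵥ ·) '' energyBall r + energyBall r

/-- `P := 1 + M Mᴴ` dominates both `1` and `M Mᴴ`, so the preimage `B P⁻¹ y` of `y = M u + v` under
`Bᴴ` has energy `⟨P⁻¹ y, y⟩`, which Cauchy-Schwarz bounds by the energies of `u` and `v`. -/
lemma noisyImage_subset [DecidableEq ι] {M B : Matrix ι ι ℂ} (hB : 1 + M * Mᴴ = Bᴴ * B) (r : ℝ) :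
    noisyImage M r ⊆ (Bᴴ *ᵥ ·) '' energyBall (2 * r) := by
  rintro _ ⟨_, ⟨u, hu, rfl⟩, v, hv, rfl⟩
  have hunit : IsUnit (1 + M * Mᴴ).det := (Matrix.isUnit_iff_isUnit_det _).1
    (Matrix.PosDef.one.add_posSemidef (Matrix.posSemidef_self_mul_conjTranspose M)).isUnit
  obtain ⟨ξ, hξ⟩ : ∃ ξ, (1 + M * Mᴴ) *ᵥ ξ = M *ᵥ u + v :=
    ⟨(1 + M * Mᴴ)⁻¹ *ᵥ (M *ᵥ u + v), by
      rw [Matrix.mulVec_mulVec, Matrix.mul_nonsing_inv _ hunit, Matrix.one_mulVec]⟩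
  refine ⟨B *ᵥ ξ, ?_, by simp only [Matrix.mulVec_mulVec, ← hB, hξ]⟩
  have henergy : energy (B *ᵥ ξ) = (star ξ ⬝ᵥ (1 + M * Mᴴ) *ᵥ ξ).re := by
    rw [energy_eq_re_dotProduct, Matrix.star_mulVec, ← Matrix.dotProduct_mulVec,
      Matrix.mulVec_mulVec, ← hB]
  have hsplit : energy (B *ᵥ ξ) = energy ξ + energy (Mᴴ *ᵥ ξ) := by
    rw [henergy, Matrix.add_mulVec, Matrix.one_mulVec, dotProduct_add, Complex.add_re,
      energy_eq_re_dotProduct, energy_eq_re_dotProduct (Mᴴ *ᵥ ξ), Matrix.star_mulVec,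
      ← Matrix.dotProduct_mulVec, Matrix.mulVec_mulVec, Matrix.conjTranspose_conjTranspose]
  have hpair : energy (B *ᵥ ξ) = (star (Mᴴ *ᵥ ξ) ⬝ᵥ u).re + (star ξ ⬝ᵥ v).re := by
    rw [henergy, hξ, dotProduct_add, Complex.add_re, Matrix.star_mulVec,
      ← Matrix.dotProduct_mulVec, Matrix.conjTranspose_conjTranspose]
  rw [mem_energyBall] at hu hv ⊢
  linarith [two_mul_re_dotProduct_le (Mᴴ *ᵥ ξ) u, two_mul_re_dotProduct_le ξ v]

lemma volume_noisyImage_le_exp_trace (M : Matrix ι ι ℂ) (r : ℝ) :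
    volume (noisyImage M r) ≤ ENNReal.ofReal (Real.exp ((M * Mᴴ).trace.re)) *
      volume (energyBall (2 * r) : Set (ι → ℂ)) := by
  classical
  have hP : (1 + M * Mᴴ).PosSemidef :=
    Matrix.PosSemidef.one.add (Matrix.posSemidef_self_mul_conjTranspose M)
  obtain ⟨B, hB⟩ := CStarAlgebra.nonneg_iff_eq_star_mul_self.1 hP.nonneg
  rw [Matrix.star_eq_conjTranspose] at hB
  have hdet : ‖Bᴴ.det‖ ^ 2 ≤ Real.exp ((M * Mᴴ).trace.re) := by
    have h := norm_det_le_exp_trace hP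
    rw [Matrix.trace_add, Matrix.trace_one, Complex.add_re, Complex.natCast_re,
      add_sub_cancel_left] at h
    rwa [hB, Matrix.det_mul, norm_mul, ← norm_star B.det, ← Matrix.det_conjTranspose, ← sq] at h
  refine (measure_mono (noisyImage_subset hB r)).trans ?_
  rw [volume_image_mulVec]
  gcongr

lemma volume_noisyImage_le {M : Matrix ι ι ℂ} {R t : ℝ} (hR : 0 ≤ R)
    (hM : (M * Mᴴ).trace.re ≤ t * Fintype.card ι) :
    volume (noisyImage M (R * Fintype.card ι)) ≤
      ENNReal.ofReal ((2 * Real.pi * Real.exp (1 + t) * R) ^ Fintype.card ι) := by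
  refine (volume_noisyImage_le_exp_trace M _).trans ?_
  calc _ ≤ ENNReal.ofReal (Real.exp t ^ Fintype.card ι) *
        ENNReal.ofReal ((Real.pi * Real.exp 1 * (2 * R)) ^ Fintype.card ι) := by
        rw [← Real.exp_nat_mul, mul_comm _ t, ← mul_assoc 2 R]
        gcongr
        exact volume_energyBall_mul_card_le (by positivity)
    _ = _ := by
        rw [← ENNReal.ofReal_mul (by positivity), ← mul_pow, Real.exp_add]
        ring_nf

lemma volume_noisyImage_mul_diagonal_le [DecidableEq ι] {A : Matrix ι ι ℂ} {d : ι → ℂ}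
    {c R t : ℝ} (hR : 0 ≤ R) (hd : ∀ j, ‖d j‖ ≤ c) (hA : (A * Aᴴ).trace.re ≤ t * Fintype.card ι) :
    volume (noisyImage (A * diagonal d) (R * Fintype.card ι)) ≤
      ENNReal.ofReal ((2 * Real.pi * Real.exp (1 + c ^ 2 * t) * R) ^ Fintype.card ι) := by
  refine volume_noisyImage_le hR ((trace_mul_diagonal_le A hd).trans ?_)
  rw [mul_assoc]
  gcongr

end Matrices

section Packing

lemma sum_measure_le_mul {X ι : Type*} [MeasurableSpace X] {μ : Measure X} {I : Finset ι}
    {D : ι → Set X} {S : Set X} {k : ENNReal} (hD : ∀ i ∈ I, MeasurableSet (D i))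
    (hS : ∀ i ∈ I, D i ⊆ S) [∀ y, DecidablePred fun i => y ∈ D i]
    (hk : ∀ y, ((I.filter fun i => y ∈ D i).card : ENNReal) ≤ k) :
    ∑ i ∈ I, μ (D i) ≤ k * μ S := by
  calc ∑ i ∈ I, μ (D i) = ∑ i ∈ I, ∫⁻ y in S, (D i).indicator 1 y ∂μ :=
        Finset.sum_congr rfl fun i hi => by
          rw [lintegral_indicator_one (hD i hi), Measure.restrict_eq_self _ (hS i hi)]
    _ = ∫⁻ y in S, ∑ i ∈ I, (D i).indicator 1 y ∂μ :=
        (lintegral_finsetSum' _ fun i hi =>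
          (measurable_one.indicator (hD i hi)).aemeasurable).symm
    _ ≤ ∫⁻ _ in S, k ∂μ := lintegral_mono fun y => by
        simpa only [Set.indicator_apply, Pi.one_apply, Finset.sum_boole] using hk y
    _ = k * μ S := setLIntegral_const _ _

variable {n : ℕ} {α β : Type*}

/-- The probability that the decoder `dec` misses the message `k` when `x` is received through
additive noise. -/
def decodingError (dec : (Fin n → ℂ) → α) (k : α) (x : Fin n → ℂ) : ℝ :=
  (blockNoise n).real {z | dec (x + z) ≠ k}

/-- The outputs decoded to `k` which differ from `x` by a noise of typical energy. By
`blockNoise_compl_energyBall_le`, a noise of energy more than `8 n` has probability at most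
`1 / 8`. -/
def decodingRegion (dec : (Fin n → ℂ) → α) (k : α) (x : Fin n → ℂ) : Set (Fin n → ℂ) :=
  {y | dec y = k ∧ y - x ∈ energyBall (8 * n)}

lemma decodingError_nonneg (dec : (Fin n → ℂ) → α) (k : α) (x : Fin n → ℂ) :
    0 ≤ decodingError dec k x := measureReal_nonneg

lemma measurableSet_decodingRegion [MeasurableSpace α] [MeasurableSingletonClass α]
    {dec : (Fin n → ℂ) → α} (hdec : Measurable dec) (k : α) (x : Fin n → ℂ) :
    MeasurableSet (decodingRegion dec k x) :=
  (hdec (measurableSet_singleton k)).inter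
    ((measurable_id.sub_const x) (measurableSet_energyBall _))

lemma le_volume_decodingRegion (dec : (Fin n → ℂ) → α) (k : α) (x : Fin n → ℂ) :
    ENNReal.ofReal (7 / 8 - decodingError dec k x) ≤ volume (decodingRegion dec k x) := by
  have hcover : (Set.univ : Set (Fin n → ℂ)) ⊆
      ({z | dec (x + z) ≠ k} ∪ (energyBall (8 * n))ᶜ) ∪ (x + ·) ⁻¹' decodingRegion dec k x := by
    intro z _
    simp only [decodingRegion, Set.mem_union, Set.mem_compl_iff, Set.mem_preimage,
      Set.mem_ofPred_eq, add_sub_cancel_left]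
    tauto
  have hunion : (1 : ℝ) ≤ decodingError dec k x + (blockNoise n).real (energyBall (8 * n))ᶜ +
      (blockNoise n).real ((x + ·) ⁻¹' decodingRegion dec k x) :=
    calc (1 : ℝ) = (blockNoise n).real Set.univ := probReal_univ.symm
      _ ≤ _ := measureReal_mono hcover
      _ ≤ _ := (measureReal_union_le _ _).trans (by gcongr; exact measureReal_union_le _ _)
  have hnoise := blockNoise_compl_energyBall_le (R := 8) (by norm_num) n
  calc ENNReal.ofReal (7 / 8 - decodingError dec k x)
      ≤ blockNoise n ((x + ·) ⁻¹' decodingRegion dec k x) :=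
        ENNReal.ofReal_le_of_le_toReal (by rw [← measureReal_def]; linarith)
    _ ≤ volume ((x + ·) ⁻¹' decodingRegion dec k x) := blockNoise_le_volume n _
    _ = volume (decodingRegion dec k x) := measure_preimage_add _ _ _

lemma sum_sub_decodingError_le [MeasurableSpace α] [MeasurableSingletonClass α]
    {dec : (Fin n → ℂ) → α} (hdec : Measurable dec) {ι : Type*} (I : Finset ι) (k : ι → α)
    (x : ι → Fin n → ℂ) {S : Set (Fin n → ℂ)} {B V : ℝ} (hB : 0 ≤ B) (hV : 0 ≤ V)
    (hS : volume S ≤ ENNReal.ofReal V)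
    (hmem : ∀ i ∈ I, ∀ z ∈ energyBall (8 * n), x i + z ∈ S)
    (hmult : ∀ y, ∀ J ⊆ I, (∀ i ∈ J, y ∈ decodingRegion dec (k i) (x i)) → (J.card : ℝ) ≤ B) :
    ∑ i ∈ I, (7 / 8 - decodingError dec (k i) (x i)) ≤ B * V := by
  classical
  have hsub : ∀ i ∈ I, decodingRegion dec (k i) (x i) ⊆ S := fun i hi y hy => by
    simpa only [add_sub_cancel] using hmem i hi _ hy.2
  have hcard (y : Fin n → ℂ) :
      ((I.filter fun i => y ∈ decodingRegion dec (k i) (x i)).card : ENNReal) ≤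
        ENNReal.ofReal B := by
    rw [← ENNReal.ofReal_natCast]
    exact ENNReal.ofReal_le_ofReal (hmult y _ (Finset.filter_subset _ _)
      fun i hi => (Finset.mem_filter.1 hi).2)
  refine (ENNReal.ofReal_le_ofReal_iff (mul_nonneg hB hV)).1 ?_
  calc ENNReal.ofReal (∑ i ∈ I, (7 / 8 - decodingError dec (k i) (x i)))
      ≤ ∑ i ∈ I, ENNReal.ofReal (7 / 8 - decodingError dec (k i) (x i)) :=
        Finset.le_sum_of_subadditive _ ENNReal.ofReal_zero.le (fun _ _ => ENNReal.ofReal_add_le) _ _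
    _ ≤ ∑ i ∈ I, volume (decodingRegion dec (k i) (x i)) :=
        Finset.sum_le_sum fun i _ => le_volume_decodingRegion dec (k i) (x i)
    _ ≤ ENNReal.ofReal B * volume S :=
        sum_measure_le_mul (fun i _ => measurableSet_decodingRegion hdec _ _) hsub hcard
    _ ≤ ENNReal.ofReal B * ENNReal.ofReal V := by gcongr
    _ = ENNReal.ofReal (B * V) := (ENNReal.ofReal_mul hB).symm

lemma card_codewords_near_le [MeasurableSpace β] [MeasurableSingletonClass β]
    {dec : (Fin n → ℂ) → β} (hdec : Measurable dec) {M : Matrix (Fin n) (Fin n) ℂ} {V : ℝ}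
    (hV : 0 ≤ V) (hM : volume (noisyImage M (8 * n)) ≤ ENNReal.ofReal V)
    (b : β → Fin n → ℂ) (s y : Fin n → ℂ) (I : Finset β)
    (hgood : ∀ k ∈ I, decodingError dec k (M *ᵥ b k + s) ≤ 1 / 2)
    (hnear : ∀ k ∈ I, y - b k ∈ energyBall (8 * n)) :
    (I.card : ℝ) ≤ 8 / 3 * V := by
  have hmem : ∀ k ∈ I, ∀ z ∈ energyBall (8 * n), M *ᵥ b k + s + z ∈
      (-(M *ᵥ y + s) + ·) ⁻¹' noisyImage M (8 * n) := fun k hk z hz => by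
    refine ⟨_, ⟨-(y - b k), ?_, rfl⟩, z, hz, ?_⟩
    · rw [mem_energyBall, energy_neg]
      exact hnear k hk
    · simp only [Matrix.mulVec_neg, Matrix.mulVec_sub]
      abel
  have hpack := sum_sub_decodingError_le hdec I id (fun k => M *ᵥ b k + s) zero_le_one hV
    ((measure_preimage_add volume _ _).trans_le hM) hmem fun w J _ hJ => by
      exact_mod_cast Finset.card_le_one.2 fun k hk l hl => (hJ k hk).1.symm.trans (hJ l hl).1
  have hlow := Finset.card_nsmul_le_sum I
    (fun k => 7 / 8 - decodingError dec k (M *ᵥ b k + s)) (3 / 8)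
    fun k hk => by linarith [hgood k hk]
  rw [nsmul_eq_mul] at hlow
  simp only [id] at hpack
  linarith

lemma card_sub_two_mul_sum_le_card_filter {ι : Type*} [Fintype ι] {f : ι → ℝ}
    (hf : ∀ i, 0 ≤ f i) :
    (Fintype.card ι : ℝ) - 2 * ∑ i, f i ≤ (Finset.univ.filter fun i => f i ≤ 1 / 2).card := by
  have hbad : ((Finset.univ.filter fun i => ¬ f i ≤ 1 / 2).card : ℝ) * (1 / 2) ≤ ∑ i, f i := by
    rw [← nsmul_eq_mul]
    exact (Finset.card_nsmul_le_sum _ f _ fun i hi =>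
      (not_le.1 (Finset.mem_filter.1 hi).2).le).trans
      (Finset.sum_le_sum_of_subset_of_nonneg (Finset.filter_subset _ _) fun i _ _ => hf i)
  have hcard : ((Finset.univ.filter fun i => f i ≤ 1 / 2).card : ℝ) +
      (Finset.univ.filter fun i => ¬ f i ≤ 1 / 2).card = Fintype.card ι := by
    exact_mod_cast Finset.card_filter_add_card_filter_not _
  linarith

/-- The packing bound behind the two-user converse. Receiver `0` sees `a k + b l` plus noise and
decodes `k`; what is left is `b l` plus noise, a blurred version of the input `b l` of the second
receiver. Since the latter decodes `l` from `M (b l) + s k` plus noise, few `l` remain possible. -/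
lemma card_mul_card_le [Fintype α] [Fintype β] [MeasurableSpace α] [MeasurableSingletonClass α]
    [MeasurableSpace β] [MeasurableSingletonClass β] {dec₀ : (Fin n → ℂ) → α}
    (hdec₀ : Measurable dec₀) {dec₁ : (Fin n → ℂ) → β} (hdec₁ : Measurable dec₁)
    (a s : α → Fin n → ℂ) (b : β → Fin n → ℂ) {M : Matrix (Fin n) (Fin n) ℂ}
    {S : Set (Fin n → ℂ)} {V W : ℝ} (hV : 0 ≤ V) (hW : 0 ≤ W)
    (hM : volume (noisyImage M (8 * n)) ≤ ENNReal.ofReal V) (hS : volume S ≤ ENNReal.ofReal W)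
    (hmem : ∀ k l, ∀ z ∈ energyBall (8 * n), a k + b l + z ∈ S)
    (herr₀ : ∑ m : α × β, decodingError dec₀ m.1 (a m.1 + b m.2) ≤
      1 / 16 * (Fintype.card α * Fintype.card β))
    (herr₁ : ∑ m : α × β, decodingError dec₁ m.2 (M *ᵥ b m.2 + s m.1) ≤
      1 / 16 * (Fintype.card α * Fintype.card β)) :
    (Fintype.card α * Fintype.card β : ℝ) ≤ 4 * (V * W) := by
  classical
  set good : Finset (α × β) :=
    Finset.univ.filter fun m => decodingError dec₁ m.2 (M *ᵥ b m.2 + s m.1) ≤ 1 / 2 with hgood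
  have hcard := card_sub_two_mul_sum_le_card_filter (ι := α × β)
    fun m => decodingError_nonneg dec₁ m.2 (M *ᵥ b m.2 + s m.1)
  rw [← hgood, Fintype.card_prod, Nat.cast_mul] at hcard
  have hmult (y : Fin n → ℂ) (J : Finset (α × β)) (hJ : J ⊆ good)
      (hy : ∀ m ∈ J, y ∈ decodingRegion dec₀ m.1 (a m.1 + b m.2)) :
      (J.card : ℝ) ≤ 8 / 3 * V := by
    have hfst (m) (hm : m ∈ J) : m.1 = dec₀ y := (hy m hm).1.symm
    rw [← Finset.card_image_of_injOn (f := Prod.snd) fun m hm m' hm' h =>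
      Prod.ext ((hfst m hm).trans (hfst m' hm').symm) h]
    refine card_codewords_near_le hdec₁ hV hM b (s (dec₀ y)) (y - a (dec₀ y)) _
      (Finset.forall_mem_image.2 fun m hm => ?_) (Finset.forall_mem_image.2 fun m hm => ?_)
    · rw [← hfst m hm]
      exact (Finset.mem_filter.1 (hJ hm)).2
    · rw [← hfst m hm, sub_sub]
      exact (hy m hm).2
  have hpack := sum_sub_decodingError_le hdec₀ good Prod.fst (fun m => a m.1 + b m.2)
    (by positivity) hW hS (fun m _ => hmem m.1 m.2) hmult
  have herr : ∑ m ∈ good, decodingError dec₀ m.1 (a m.1 + b m.2) ≤ _ :=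
    (Finset.sum_le_sum_of_subset_of_nonneg (Finset.subset_univ _) fun m _ _ =>
      decodingError_nonneg _ _ _).trans herr₀
  rw [Finset.sum_sub_distrib, Finset.sum_const, nsmul_eq_mul] at hpack
  linarith [mul_nonneg hV hW]

end Packing

section Measurability

lemma measurable_matrix_iff {α : Type*} [MeasurableSpace α] {n : ℕ}
    {f : α → Matrix (Fin n) (Fin n) ℂ} :
    Measurable f ↔ ∀ i j, Measurable fun x => f x i j :=
  (measurable_pi_iff (X := fun _ => Fin n → ℂ)).trans
    (forall_congr' fun _ => measurable_pi_iff)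

variable {K n : ℕ}

@[fun_prop]
lemma measurable_knownCSI (U : Fin K → Fin K → Finset (Fin n)) : Measurable (knownCSI U) := by
  simp only [measurable_pi_iff, knownCSI]
  intro p q j
  split_ifs <;> fun_prop

@[fun_prop]
lemma measurable_directMatrix (p : Fin K) :
    Measurable fun s : ChannelState K n => directMatrix s.1 s.2.1 p := by
  have hF : Measurable fun s : ChannelState K n => s.2.1 p := by fun_prop
  refine measurable_matrix_iff.2 fun i j => ?_
  simp only [directMatrix, Matrix.mul_diagonal]
  exact (measurable_matrix_iff.1 hF i j).mul (by fun_prop)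

lemma measurable_received {x : ChannelState K n → Fin K → Fin n → ℂ}
    (hx : ∀ q, Measurable fun s => x s q) (p : Fin K) :
    Measurable fun s => received s (x s) p := by
  have hx' (q) (j) : Measurable fun s => x s q j := (measurable_pi_apply j).comp (hx q)
  have hdirect (j) : Measurable fun s => (directMatrix s.1 s.2.1 p).mulVec (x s p) j := by
    simp only [Matrix.mulVec, dotProduct]
    exact Finset.measurable_fun_sum _ fun i _ =>
      (measurable_matrix_iff.1 (measurable_directMatrix p) j i).mul (hx' p i)
  exact measurable_pi_iff.2 fun j =>
    (Measurable.add (by fun_prop) (hdirect j)).add (by fun_prop)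

lemma Code.measurableSet_errorEvent {N : Fin K → ℕ} (c : Code K n N)
    (U : Fin K → Fin K → Finset (Fin n)) (m : (q : Fin K) → Fin (N q)) :
    MeasurableSet (c.errorEvent U m) := by
  have hknown : Measurable fun s : ChannelState K n => knownCSI U s.1 := by fun_prop
  have hdec (p : Fin K) : Measurable fun s : ChannelState K n =>
      c.dec p (received s (fun q => c.enc q (m q) (knownCSI U s.1)) p, knownCSI U s.1,
        directMatrix s.1 s.2.1 p) :=
    (c.dec_measurable p).comp
      ((measurable_received (fun q => (c.enc_measurable q (m q)).comp hknown) p).prodMk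
        (hknown.prodMk (measurable_directMatrix p)))
  simp only [errorEvent, Set.ofPred_exists]
  exact MeasurableSet.iUnion fun p => (measurableSet_eq_fun (hdec p) measurable_const).compl

end Measurability

section Laws

/-- The joint law of the fading coefficients. -/
def ChannelLaw.fadingLaw (L : ChannelLaw) (K n : ℕ) : Measure (Fading K n) :=
  Measure.pi fun _ => Measure.pi fun _ => Measure.pi fun _ => L.fading

/-- The joint law of the matrices `F_p`. -/
def ChannelLaw.directLaw (L : ChannelLaw) (K n : ℕ) :
    Measure (Fin K → Matrix (Fin n) (Fin n) ℂ) :=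
  Measure.pi fun p => L.direct p n

/-- The joint law of the noise at all receivers. -/
def noisesLaw (K n : ℕ) : Measure (Fin K → Fin n → ℂ) := Measure.pi fun _ => blockNoise n

variable (L : ChannelLaw) (K n : ℕ)

instance ChannelLaw.isProbabilityMeasure_fadingLaw : IsProbabilityMeasure (L.fadingLaw K n) := by
  unfold ChannelLaw.fadingLaw
  infer_instance

instance ChannelLaw.isProbabilityMeasure_directLaw : IsProbabilityMeasure (L.directLaw K n) := by
  unfold ChannelLaw.directLaw
  infer_instance

instance isProbabilityMeasure_noisesLaw : IsProbabilityMeasure (noisesLaw K n) := by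
  unfold noisesLaw
  infer_instance

lemma ChannelLaw.stateLaw_eq :
    L.stateLaw K n = (L.fadingLaw K n).prod ((L.directLaw K n).prod (noisesLaw K n)) := rfl

instance ChannelLaw.isProbabilityMeasure_stateLaw : IsProbabilityMeasure (L.stateLaw K n) := by
  rw [L.stateLaw_eq]
  infer_instance

lemma ChannelLaw.ae_fadingLaw {P : ℂ → Prop} (hP : ∀ᵐ z ∂L.fading, P z) :
    ∀ᵐ h ∂(L.fadingLaw K n), ∀ p q j, P (h p q j) := by
  simp only [ae_all_iff]
  intro p q j
  have heval : MeasurePreserving (fun h : Fading K n => h p q j) (L.fadingLaw K n) L.fading :=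
    (measurePreserving_eval (fun _ : Fin n => L.fading) j).comp
      ((measurePreserving_eval (fun _ : Fin K => Measure.pi fun _ : Fin n => L.fading) q).comp
        (measurePreserving_eval (fun _ : Fin K =>
          Measure.pi fun _ : Fin K => Measure.pi fun _ : Fin n => L.fading) p))
  exact heval.quasiMeasurePreserving.ae hP

lemma ChannelLaw.tendsto_directLaw_trace_gt :
    Tendsto (fun n : ℕ => L.directLaw K n {F | ∃ p, 2 * n < (F p * (F p)ᴴ).trace.re})
      atTop (𝓝 0) := by
  have hsum : Tendsto (fun n : ℕ => ∑ p : Fin K,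
      L.direct p n {F | 1 ≤ |(F * Fᴴ).trace.re / n - 1|}) atTop (𝓝 0) := by
    simpa only [Finset.sum_const_zero] using
      tendsto_finsetSum Finset.univ fun (p : Fin K) _ => L.direct_trace p 1 one_pos
  refine tendsto_of_tendsto_of_tendsto_of_le_of_le' tendsto_const_nhds hsum
    (Eventually.of_forall fun _ => zero_le) ?_
  filter_upwards [eventually_gt_atTop 0] with n hn
  have hn' : (0 : ℝ) < n := Nat.cast_pos.2 hn
  have hsub : {F : Fin K → Matrix (Fin n) (Fin n) ℂ | ∃ p, 2 * n < (F p * (F p)ᴴ).trace.re} ⊆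
      ⋃ p, (fun F => F p) ⁻¹' {F | 1 ≤ |(F * Fᴴ).trace.re / n - 1|} := by
    rintro F ⟨p, hp⟩
    rw [← lt_div_iff₀ hn'] at hp
    have hdev : 1 ≤ (F p * (F p)ᴴ).trace.re / n - 1 := by linarith
    exact Set.mem_iUnion.2 ⟨p, hdev.trans (le_abs_self _)⟩
  refine (measure_mono hsub).trans ((measure_iUnion_fintype_le _ _).trans ?_)
  exact Finset.sum_le_sum fun p _ =>
    (measurePreserving_eval (fun p : Fin K => L.direct p n) p).measure_preimage_le _

end Laws

section TypicalRealization

lemma exists_mem_le_of_lintegral_le {X : Type*} [MeasurableSpace X] {μ : Measure X}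
    [IsProbabilityMeasure μ] {s : Set X} (hs : 1 / 2 ≤ μ s) {f : X → ENNReal}
    (hf : Measurable f) : ∃ x ∈ s, f x ≤ 2 * ∫⁻ x, f x ∂μ := by
  have hpos : μ s ≠ 0 := fun h => by simp [h] at hs
  obtain ⟨x, hx, hle⟩ := exists_le_setLAverage hpos (measure_ne_top μ s) hf.aemeasurable
  refine ⟨x, hx, hle.trans ?_⟩
  rw [setLAverage_eq, ENNReal.div_eq_inv_mul]
  exact mul_le_mul' (ENNReal.inv_le_iff_inv_le.2 (by simpa using hs))
    (setLIntegral_le_lintegral _ _)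

variable (L : ChannelLaw) (K : ℕ) {n : ℕ}

lemma ChannelLaw.lintegral_noisesLaw {E : Set (ChannelState K n)} (hE : MeasurableSet E) :
    ∫⁻ w, noisesLaw K n {z | (w.1, w.2, z) ∈ E} ∂((L.fadingLaw K n).prod (L.directLaw K n)) =
      L.stateLaw K n E := by
  rw [L.stateLaw_eq, ← (measurePreserving_prodAssoc (L.fadingLaw K n) (L.directLaw K n)
    (noisesLaw K n)).measure_preimage hE.nullMeasurableSet,
    Measure.prod_apply (MeasurableEquiv.prodAssoc.measurable hE)]
  rfl

/-- The channel coefficients and matrices whose energies are of the expected order. -/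
def typicalChannels (a b : ℝ) (K n : ℕ) :
    Set (Fading K n × (Fin K → Matrix (Fin n) (Fin n) ℂ)) :=
  {w | (∀ p q j, a ≤ ‖w.1 p q j‖ ∧ ‖w.1 p q j‖ ≤ b) ∧
    ∀ p, (w.2 p * (w.2 p)ᴴ).trace.re ≤ 2 * n}

lemma ChannelLaw.eventually_half_le_typicalChannels {a b : ℝ}
    (hab : ∀ᵐ h ∂L.fading, a ≤ ‖h‖ ∧ ‖h‖ ≤ b) :
    ∀ᶠ n in atTop,
      1 / 2 ≤ (L.fadingLaw K n).prod (L.directLaw K n) (typicalChannels a b K n) := by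
  filter_upwards [(L.tendsto_directLaw_trace_gt K).eventually
    (ge_mem_nhds (show (0 : ENNReal) < 1 / 2 by simp))] with n hn
  have hfading : (L.fadingLaw K n).prod (L.directLaw K n)
      {w | ¬ ∀ p q j, a ≤ ‖w.1 p q j‖ ∧ ‖w.1 p q j‖ ≤ b} = 0 :=
    measurePreserving_fst.quasiMeasurePreserving.ae (L.ae_fadingLaw K n hab)
  have hdirect : (L.fadingLaw K n).prod (L.directLaw K n)
      {w | ∃ p, 2 * n < (w.2 p * (w.2 p)ᴴ).trace.re} ≤ 1 / 2 :=
    (measurePreserving_snd.measure_preimage_le _).trans hn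
  have hcompl : (L.fadingLaw K n).prod (L.directLaw K n) (typicalChannels a b K n)ᶜ ≤ 1 / 2 := by
    refine (measure_mono fun w hw => ?_).trans ((measure_union_le _ _).trans
      ((add_le_add hfading.le hdirect).trans_eq (zero_add _)))
    simpa only [typicalChannels, Set.mem_compl_iff, Set.mem_ofPred_eq, not_and_or, not_forall,
      not_le, Set.mem_union] using hw
  refine ENNReal.le_of_add_le_add_right (a := 1 / 2) (by simp) ?_
  calc (1 / 2 + 1 / 2 : ENNReal) = (L.fadingLaw K n).prod (L.directLaw K n) Set.univ := by
        rw [ENNReal.add_halves, measure_univ]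
    _ ≤ _ := (measure_univ_le_add_compl _).trans (by gcongr)

lemma ChannelLaw.exists_mem_typicalChannels {a b : ℝ}
    (htyp : 1 / 2 ≤ (L.fadingLaw K n).prod (L.directLaw K n) (typicalChannels a b K n))
    {ι : Type*} [Fintype ι] {E : ι → Set (ChannelState K n)} (hE : ∀ i, MeasurableSet (E i)) :
    ∃ w ∈ typicalChannels a b K n, ∑ i, (noisesLaw K n).real {z | (w.1, w.2, z) ∈ E i} ≤
      2 * ∑ i, (L.stateLaw K n).real (E i) := by
  have hmeas (i) : Measurable fun w : Fading K n × (Fin K → Matrix (Fin n) (Fin n) ℂ) =>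
      noisesLaw K n {z | (w.1, w.2, z) ∈ E i} :=
    measurable_measure_prodMk_left (MeasurableEquiv.prodAssoc.measurable (hE i))
  obtain ⟨w, hw, hle⟩ := exists_mem_le_of_lintegral_le htyp
    (Finset.measurable_fun_sum Finset.univ fun i _ => hmeas i)
  rw [lintegral_finsetSum _ fun i _ => hmeas i] at hle
  simp only [L.lintegral_noisesLaw K (hE _)] at hle
  have hreal := ENNReal.toReal_mono
    (ENNReal.mul_ne_top ENNReal.ofNat_ne_top (by simp [ENNReal.sum_eq_top])) hle
  rw [ENNReal.toReal_mul, ENNReal.toReal_sum fun i _ => measure_ne_top _ _,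
    ENNReal.toReal_sum fun i _ => measure_ne_top _ _] at hreal
  exact ⟨w, hw, hreal⟩

end TypicalRealization

section TwoUsers

variable {n : ℕ}

lemma received_zero (h : Fading 2 n) (F : Fin 2 → Matrix (Fin n) (Fin n) ℂ)
    (z x : Fin 2 → Fin n → ℂ) :
    received (h, F, z) x 0 = directMatrix h F 0 *ᵥ x 0 + h 0 1 * x 1 + z 0 := by
  have hcross : Finset.univ.erase (0 : Fin 2) = {1} := by decide
  funext j
  simp only [received, hcross, Finset.sum_singleton, Pi.add_apply, Pi.mul_apply]
  ring

/-- The useful signal is written in terms of the interference `h 0 1 * x 1` seen by receiver `0`. -/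
lemma received_one (h : Fading 2 n) (F : Fin 2 → Matrix (Fin n) (Fin n) ℂ)
    (z x : Fin 2 → Fin n → ℂ) (h0 : ∀ j, h 0 1 j ≠ 0) :
    received (h, F, z) x 1 =
      (F 1 * diagonal (h 1 1 / h 0 1)) *ᵥ (h 0 1 * x 1) + h 1 0 * x 0 + z 1 := by
  have hcross : Finset.univ.erase (1 : Fin 2) = {0} := by decide
  have hdirect : (F 1 * diagonal (h 1 1 / h 0 1)) *ᵥ (h 0 1 * x 1) =
      directMatrix h F 1 *ᵥ x 1 := by
    rw [directMatrix, ← Matrix.mulVec_mulVec, ← Matrix.mulVec_mulVec]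
    congr 1
    funext j
    simp only [Matrix.mulVec_diagonal, Pi.mul_apply, Pi.div_apply]
    rw [← mul_assoc, div_mul_cancel₀ _ (h0 j)]
  rw [hdirect]
  funext j
  simp only [received, hcross, Finset.sum_singleton, Pi.add_apply, Pi.mul_apply]
  ring

lemma blockNoise_le_noisesLaw {K : ℕ} (p : Fin K) {A : Set (Fin n → ℂ)}
    {B : Set (Fin K → Fin n → ℂ)} (hA : MeasurableSet A) (hAB : ∀ z, z p ∈ A → z ∈ B) :
    (blockNoise n).real A ≤ (noisesLaw K n).real B := by
  rw [← (measurePreserving_eval (fun _ : Fin K => blockNoise n) p).measureReal_preimage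
    hA.nullMeasurableSet]
  exact measureReal_mono hAB

lemma Code.HasPower.energy_le {K : ℕ} {N : Fin K → ℕ} {c : Code K n N} {ρ : ℝ}
    (hpow : c.HasPower ρ) (m : ∀ q, Fin (N q)) (q : Fin K) (θ : Fading K n) :
    energy (c.enc q (m q) θ) ≤ n * ρ :=
  (Finset.single_le_sum (f := fun q => energy (c.enc q (m q) θ))
    (fun _ _ => Finset.sum_nonneg fun _ _ => sq_nonneg _) (Finset.mem_univ q)).trans (hpow m θ)

/-- The output of receiver `p` when `h` and `F` are realized, as a decoder of its noisy signal. -/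
def Code.decAt {K : ℕ} {N : Fin K → ℕ} (c : Code K n N) (U : Fin K → Fin K → Finset (Fin n))
    (h : Fading K n) (F : Fin K → Matrix (Fin n) (Fin n) ℂ) (p : Fin K) (y : Fin n → ℂ) :
    Fin (N p) :=
  c.dec p (y, knownCSI U h, directMatrix h F p)

lemma Code.measurable_decAt {K : ℕ} {N : Fin K → ℕ} (c : Code K n N)
    (U : Fin K → Fin K → Finset (Fin n)) (h : Fading K n)
    (F : Fin K → Matrix (Fin n) (Fin n) ℂ) (p : Fin K) : Measurable (c.decAt U h F p) :=
  (c.dec_measurable p).comp (by fun_prop)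

lemma Code.decodingError_decAt_le {K : ℕ} {N : Fin K → ℕ} (c : Code K n N)
    (U : Fin K → Fin K → Finset (Fin n)) (h : Fading K n)
    (F : Fin K → Matrix (Fin n) (Fin n) ℂ) (p : Fin K) (m : ∀ q, Fin (N q)) {y : Fin n → ℂ}
    (hy : ∀ z, received (h, F, z) (fun q => c.enc q (m q) (knownCSI U h)) p = y + z p) :
    decodingError (c.decAt U h F p) (m p) y ≤
      (noisesLaw K n).real {z | (h, F, z) ∈ c.errorEvent U m} := by
  refine blockNoise_le_noisesLaw p (measurableSet_eq_fun
    ((c.measurable_decAt U h F p).comp (by fun_prop)) measurable_const).compl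
    fun z hz => ⟨p, ?_⟩
  rw [hy]
  exact hz

lemma Code.card_mul_card_le_at {N : Fin 2 → ℕ} (c : Code 2 n N)
    (U : Fin 2 → Fin 2 → Finset (Fin n)) {ρ a b V W : ℝ} (ha : 0 < a) (hV : 0 ≤ V) (hW : 0 ≤ W)
    (hρ : 1 ≤ ρ) (hpow : c.HasPower ρ) {h : Fading 2 n}
    {F : Fin 2 → Matrix (Fin n) (Fin n) ℂ} (hh : ∀ p q j, a ≤ ‖h p q j‖ ∧ ‖h p q j‖ ≤ b)
    (hM : volume (noisyImage (F 1 * diagonal (h 1 1 / h 0 1)) (8 * n)) ≤ ENNReal.ofReal V)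
    (hS : volume (noisyImage (directMatrix h F 0) ((2 * b ^ 2 + 16) * ρ * n)) ≤ ENNReal.ofReal W)
    (herr : ∑ m, (noisesLaw 2 n).real {z | (h, F, z) ∈ c.errorEvent U m} ≤
      1 / 16 * (N 0 * N 1)) :
    (N 0 * N 1 : ℝ) ≤ 4 * (V * W) := by
  set θ := knownCSI U h
  have hh0 (j) : h 0 1 j ≠ 0 := norm_pos_iff.1 (ha.trans_le (hh 0 1 j).1)
  have hmem (k l) (z) (hz : z ∈ energyBall (8 * n)) :
      directMatrix h F 0 *ᵥ c.enc 0 k θ + h 0 1 * c.enc 1 l θ + z ∈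
        noisyImage (directMatrix h F 0) ((2 * b ^ 2 + 16) * ρ * n) := by
    have hpowk := hpow.energy_le ((piFinTwoEquiv fun q => Fin (N q)).symm (k, l)) 0 θ
    have hpowl := hpow.energy_le ((piFinTwoEquiv fun q => Fin (N q)).symm (k, l)) 1 θ
    have hinterf := energy_mul_le (fun j => (hh 0 1 j).2) (c.enc 1 l θ)
    have hsum := energy_add_le (h 0 1 * c.enc 1 l θ) z
    have hscale : b ^ 2 * energy (c.enc 1 l θ) ≤ b ^ 2 * (n * ρ) := by gcongr; exact hpowl
    have hnρ : (n : ℝ) ≤ n * ρ := le_mul_of_one_le_right n.cast_nonneg hρ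
    have hbnρ : 0 ≤ b ^ 2 * (n * ρ) := by positivity
    rw [add_assoc]
    refine Set.add_mem_add ⟨_, mem_energyBall.2 (hpowk.trans ?_), rfl⟩ (mem_energyBall.2 ?_)
    · linarith
    · linarith [mem_energyBall.1 hz]
  have hpacking := InterferenceChannel.card_mul_card_le (c.measurable_decAt U h F 0)
    (c.measurable_decAt U h F 1) (fun k => directMatrix h F 0 *ᵥ c.enc 0 k θ)
    (fun k => h 1 0 * c.enc 0 k θ) (fun l => h 0 1 * c.enc 1 l θ) hV hW hM hS hmem
  simp only [Fintype.card_fin, ← (piFinTwoEquiv fun q => Fin (N q)).sum_comp] at hpacking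
  exact hpacking
    ((Finset.sum_le_sum fun m _ =>
      c.decodingError_decAt_le U h F 0 m fun z => received_zero ..).trans herr)
    ((Finset.sum_le_sum fun m _ =>
      c.decodingError_decAt_le U h F 1 m fun z => received_one (h0 := hh0) ..).trans herr)

lemma ChannelLaw.exists_card_mul_card_le (L : ChannelLaw) :
    ∃ C : ℝ, 0 < C ∧ ∀ᶠ n : ℕ in atTop, ∀ (U : Fin 2 → Fin 2 → Finset (Fin n)) (ρ : ℝ)
      (N : Fin 2 → ℕ) (c : Code 2 n N), 1 ≤ ρ → c.HasPower ρ → c.errorProb L U ≤ 1 / 32 →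
        (N 0 * N 1 : ℝ) ≤ 4 * (C * ρ) ^ n := by
  obtain ⟨a, b, ha, hab⟩ := L.fading_bounded
  set v : ℝ := 2 * Real.pi * Real.exp (1 + (b / a) ^ 2 * 2) * 8
  set w : ℝ := 2 * Real.pi * Real.exp (1 + b ^ 2 * 2)
  refine ⟨v * (w * (2 * b ^ 2 + 16)), by positivity, ?_⟩
  filter_upwards [L.eventually_half_le_typicalChannels 2 hab] with n htyp U ρ N c hρ hpow herr
  rcases (show (0 : ℝ) ≤ N 0 * N 1 by positivity).eq_or_lt with hN | hN
  · rw [← hN]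
    positivity
  obtain ⟨⟨h, F⟩, ⟨hh, hF⟩, hle⟩ :=
    L.exists_mem_typicalChannels 2 htyp fun m => c.measurableSet_errorEvent U m
  have hratio (j) : ‖(h 1 1 / h 0 1) j‖ ≤ b / a := by
    rw [Pi.div_apply, norm_div]
    exact div_le_div₀ ((norm_nonneg _).trans (hh 1 1 j).2) (hh 1 1 j).2 ha (hh 0 1 j).1
  have hM := volume_noisyImage_mul_diagonal_le (R := 8) (by norm_num) hratio
    (by simpa only [Fintype.card_fin] using hF 1)
  have hS := volume_noisyImage_mul_diagonal_le (R := (2 * b ^ 2 + 16) * ρ) (by positivity)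
    (fun j => (hh 0 0 j).2) (by simpa only [Fintype.card_fin] using hF 0)
  rw [Fintype.card_fin] at hM hS
  rw [Code.errorProb, Fin.prod_univ_two, div_le_iff₀ hN] at herr
  calc (N 0 * N 1 : ℝ) ≤ 4 * (v ^ n * (w * ((2 * b ^ 2 + 16) * ρ)) ^ n) :=
        c.card_mul_card_le_at U ha (by positivity) (by positivity) hρ hpow hh hM hS (by linarith)
    _ = 4 * (v * (w * (2 * b ^ 2 + 16)) * ρ) ^ n := by
        rw [← mul_pow]
        ring_nf

lemma ChannelLaw.exists_add_le_logb_add (L : ChannelLaw) :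
    ∃ C : ℝ, ∀ (U : CSIPattern 2) (ρ : ℝ), 1 ≤ ρ → ∀ R ∈ L.capacityRegion U ρ,
      R 0 + R 1 ≤ Real.logb 2 ρ + C := by
  obtain ⟨C, hC0, hC⟩ := L.exists_card_mul_card_le
  refine ⟨Real.logb 2 (4 * C), fun U ρ hρ => ?_⟩
  have hρ0 : 0 < ρ := by linarith
  refine closure_minimal (t := {R : Fin 2 → ℝ | R 0 + R 1 ≤ Real.logb 2 ρ + Real.logb 2 (4 * C)})
    ?_ (isClosed_le (by fun_prop) continuous_const)
  rintro R ⟨-, hR⟩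
  obtain ⟨n, ⟨hcard, N, c, hN, hpow, herr⟩, hn⟩ :=
    ((hC.and (hR (1 / 32) (by norm_num))).and (eventually_gt_atTop 0)).exists
  have hpow_le : (2 : ℝ) ^ (n * (R 0 + R 1)) ≤ (4 * C * ρ) ^ n := by
    calc (2 : ℝ) ^ (n * (R 0 + R 1)) = 2 ^ (n * R 0) * 2 ^ (n * R 1) := by
          rw [mul_add, Real.rpow_add two_pos]
      _ ≤ N 0 * N 1 := by
          gcongr
          exacts [hN 0, hN 1]
      _ ≤ 4 * (C * ρ) ^ n := hcard (U n) ρ N c hρ hpow herr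
      _ ≤ 4 ^ n * (C * ρ) ^ n := by
          gcongr
          exact le_self_pow₀ (by norm_num) hn.ne'
      _ = (4 * C * ρ) ^ n := by rw [← mul_pow, mul_assoc]
  have hlog := Real.logb_le_logb_of_le one_lt_two (by positivity) hpow_le
  rw [Real.logb_rpow two_pos (by norm_num), Real.logb_pow] at hlog
  have hsum := le_of_mul_le_mul_left hlog (Nat.cast_pos.2 hn)
  rwa [Real.logb_mul (by positivity) hρ0.ne', add_comm (Real.logb 2 (4 * C))] at hsum

lemma ChannelLaw.add_le_one_of_mem_dofRegion (L : ChannelLaw) {U : CSIPattern 2}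
    {d : Fin 2 → ℝ} (hd : d ∈ L.dofRegion U) : d 0 + d 1 ≤ 1 := by
  obtain ⟨C, hC⟩ := L.exists_add_le_logb_add
  have hsup := hd.2 (fun _ => 1) fun _ => zero_le_one
  simp only [one_mul, Fin.sum_univ_two] at hsup
  have hlim : Tendsto (fun ρ : ℝ => ((1 + C / Real.logb 2 ρ : ℝ) : EReal)) atTop
      (𝓝 (1 : ℝ)) := by
    refine (continuous_coe_real_ereal.tendsto _).comp ?_
    simpa only [add_zero] using
      ((Real.tendsto_logb_atTop one_lt_two).const_div_atTop C).const_add 1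
  rw [← EReal.coe_le_coe_iff]
  refine hsup.trans (le_trans (limsup_le_limsup ?_) hlim.limsup_eq.le)
  filter_upwards [eventually_gt_atTop 1] with ρ hρ
  refine iSup₂_le fun R hR => EReal.coe_le_coe_iff.2 ?_
  have hlog : 0 < Real.logb 2 ρ := Real.logb_pos one_lt_two hρ
  rw [div_le_iff₀ hlog, add_mul, div_mul_cancel₀ _ hlog.ne', one_mul]
  exact hC U ρ hρ.le R hR

end TwoUsers

section Users

variable {ι ι' : Type*}

lemma sum_eq_sum_comp_add_sum_compl [Fintype ι] [Fintype ι'] [DecidableEq ι] {M : Type*}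
    [AddCommMonoid M] (e : ι' ↪ ι) (f : ι → M) :
    ∑ i, f i = ∑ i', f (e i') + ∑ i : {i // i ∉ Set.range e}, f i := by
  rw [← Fintype.sum_subtype_add_sum_subtype (· ∈ Set.range e) f]
  congr 1
  convert! ((Equiv.ofInjective e e.injective).sum_comp fun i => f i).symm

/-- A family indexed by `ι`, as a family over the range of `e` and one over its complement. -/
def splitEquiv [Fintype ι'] [DecidableEq ι] (e : ι' ↪ ι) (X : ι → Type*) :
    ((i : ι) → X i) ≃ ((i' : ι') → X (e i')) × ((i : {i // i ∉ Set.range e}) → X i) :=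
  (Equiv.piEquivPiSubtypeProd (· ∈ Set.range e) X).trans <|
    Equiv.prodCongrLeft fun _ =>
      (Equiv.piCongrLeft (fun i : Set.range e => X i) (Equiv.ofInjective e e.injective)).symm

variable {α : Type*}

/-- The array indexed by pairs that is `f` on the pairs in the range of `e` and `g` elsewhere. -/
def extendLinks (e : ι' ↪ ι) (f : ι' → ι' → α) (g : ι → ι → α) : ι → ι → α := fun p q =>
  Function.extend (Prod.map e e) (fun i => f i.1 i.2) (fun i => g i.1 i.2) (p, q)

variable {e : ι' ↪ ι}

@[simp]
lemma extendLinks_apply (f : ι' → ι' → α) (g : ι → ι → α) (p q : ι') :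
    extendLinks e f g (e p) (e q) = f p q :=
  (e.injective.prodMap e.injective).extend_apply _ _ (p, q)

lemma extendLinks_of_notMem (f : ι' → ι' → α) (g : ι → ι → α) {p q : ι}
    (h : ¬(p ∈ Set.range e ∧ q ∈ Set.range e)) : extendLinks e f g p q = g p q := by
  refine Function.extend_apply' _ _ _ ?_
  rintro ⟨r, hr⟩
  exact h ⟨⟨r.1, congrArg Prod.fst hr⟩, ⟨r.2, congrArg Prod.snd hr⟩⟩

lemma extendLinks_comp (h g : ι → ι → α) (p q : ι)
    [Decidable (p ∈ Set.range e ∧ q ∈ Set.range e)] :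
    extendLinks e (fun p q => h (e p) (e q)) g p q =
      if p ∈ Set.range e ∧ q ∈ Set.range e then h p q else g p q := by
  split_ifs with hpq
  · obtain ⟨⟨p, rfl⟩, q, rfl⟩ := hpq
    exact extendLinks_apply _ _ p q
  · exact extendLinks_of_notMem _ _ hpq

lemma measurable_extendLinks [MeasurableSpace α] (g : ι → ι → α) :
    Measurable fun f : ι' → ι' → α => extendLinks e f g := by
  refine measurable_pi_iff.2 fun p => measurable_pi_iff.2 fun q => ?_
  by_cases h : p ∈ Set.range e ∧ q ∈ Set.range e
  · obtain ⟨⟨p, rfl⟩, q, rfl⟩ := h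
    simp only [extendLinks_apply]
    fun_prop
  · simp only [extendLinks_of_notMem _ _ h]
    fun_prop

lemma knownCSI_extendLinks {K M n : ℕ} {e : Fin M ↪ Fin K} (U : Fin K → Fin K → Finset (Fin n))
    (f : Fading M n) (g : Fading K n) :
    knownCSI U (extendLinks e f g) =
      extendLinks e (knownCSI (fun p q => U (e p) (e q)) f) (knownCSI U g) := by
  funext p q j
  by_cases h : p ∈ Set.range e ∧ q ∈ Set.range e
  · obtain ⟨⟨p, rfl⟩, q, rfl⟩ := h
    simp only [extendLinks_apply, knownCSI]
  · simp only [extendLinks_of_notMem _ _ h, knownCSI]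

end Users

section SubchannelLaw

lemma measurePreserving_pi_comp {ι ι' : Type*} [Fintype ι] [Fintype ι'] {X : ι → Type*}
    [∀ i, MeasurableSpace (X i)] (μ : (i : ι) → Measure (X i)) [∀ i, IsProbabilityMeasure (μ i)]
    (e : ι' ↪ ι) :
    MeasurePreserving (fun (x : (i : ι) → X i) (i : ι') => x (e i)) (Measure.pi μ)
      (Measure.pi fun i => μ (e i)) := by
  have hindep : iIndepFun (fun (i : ι') (x : (i : ι) → X i) => x (e i)) (Measure.pi μ) :=
    (iIndepFun_pi (X := fun _ => id) fun _ => aemeasurable_id).precomp e.injective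
  refine ⟨by fun_prop, ?_⟩
  rw [(iIndepFun_iff_map_fun_eq_pi_map fun i' => (measurable_pi_apply (e i')).aemeasurable).1
    hindep]
  simp only [(measurePreserving_eval μ (e _)).map_eq]

lemma measurePreserving_pi_prod {ι X : Type*} [Fintype ι] [MeasurableSpace X]
    (μ : ι → Measure X) [∀ i, IsProbabilityMeasure (μ i)] (f : ι → X × X → X)
    (hf : ∀ i, MeasurePreserving (f i) ((μ i).prod (μ i)) (μ i)) :
    MeasurePreserving (fun (w : (ι → X) × (ι → X)) (i : ι) => f i (w.1 i, w.2 i))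
      ((Measure.pi μ).prod (Measure.pi μ)) (Measure.pi μ) :=
  (measurePreserving_pi (fun i => (μ i).prod (μ i)) μ hf).comp
    (measurePreserving_arrowProdEquivProdArrow X X ι μ μ).symm

variable {K M n : ℕ}

/-- The law of the channel in which user `p < M` is the user `e p` of the original channel. The
laws of the matrices of the users `p ≥ M`, which an `M`-user channel does not have, are kept. -/
def ChannelLaw.comap (L : ChannelLaw) (e : Fin M ↪ Fin K) : ChannelLaw where
  fading := L.fading
  fading_prob := L.fading_prob
  fading_noAtoms := L.fading_noAtoms
  fading_bounded := L.fading_bounded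
  fading_secondMoment := L.fading_secondMoment
  direct p := L.direct (if h : p < M then e ⟨p, h⟩ else p)
  direct_prob _ := L.direct_prob _
  direct_fullRank _ := L.direct_fullRank _
  direct_trace _ := L.direct_trace _

lemma ChannelLaw.comap_castLEEmb (L : ChannelLaw) (h : M ≤ K) :
    L.comap (Fin.castLEEmb h) = L := by
  simp [ChannelLaw.comap]

/-- The pattern of the users in the range of `e`. -/
def CSIPattern.comap (U : CSIPattern K) (e : Fin M ↪ Fin K) : CSIPattern M :=
  fun n p q => U n (e p) (e q)

/-- The channel state of the users in the range of `e`. -/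
def restrictState (e : Fin M ↪ Fin K) (s : ChannelState K n) : ChannelState M n :=
  (fun p q => s.1 (e p) (e q), fun p => s.2.1 (e p), fun p => s.2.2 (e p))

/-- The state `s`, with the coefficients of `g` on all the links that involve a user outside the
range of `e`. -/
def replaceLinks (e : Fin M ↪ Fin K) (g : Fading K n) (s : ChannelState K n) :
    ChannelState K n :=
  (extendLinks e (restrictState e s).1 g, s.2)

variable (L : ChannelLaw) (e : Fin M ↪ Fin K)

lemma measurePreserving_restrictState :
    MeasurePreserving (restrictState (n := n) e) (L.stateLaw K n) ((L.comap e).stateLaw M n) := by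
  have hfading : MeasurePreserving (fun (h : Fading K n) (p q : Fin M) => h (e p) (e q))
      (L.fadingLaw K n) ((L.comap e).fadingLaw M n) :=
    (measurePreserving_pi _ _ fun _ : Fin M => measurePreserving_pi_comp
      (fun _ : Fin K => Measure.pi fun _ : Fin n => L.fading) e).comp
      (measurePreserving_pi_comp
        (fun _ : Fin K => Measure.pi fun _ : Fin K => Measure.pi fun _ : Fin n => L.fading) e)
  have hdirect : MeasurePreserving (fun (F : Fin K → Matrix (Fin n) (Fin n) ℂ) p => F (e p))
      (L.directLaw K n) ((L.comap e).directLaw M n) := by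
    simpa [ChannelLaw.directLaw, ChannelLaw.comap] using
      measurePreserving_pi_comp (fun p : Fin K => L.direct p n) e
  have hnoise : MeasurePreserving (fun (z : Fin K → Fin n → ℂ) (p : Fin M) => z (e p))
      (noisesLaw K n) (noisesLaw M n) :=
    measurePreserving_pi_comp (fun _ : Fin K => blockNoise n) e
  exact hfading.prod (hdirect.prod hnoise)

lemma measurePreserving_extendLinks :
    MeasurePreserving (fun w : Fading K n × Fading K n =>
      extendLinks e (fun p q => w.2 (e p) (e q)) w.1)
      ((L.fadingLaw K n).prod (L.fadingLaw K n)) (L.fadingLaw K n) := by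
  classical
  have hlink (p q : Fin K) : MeasurePreserving
      (fun x : (Fin n → ℂ) × (Fin n → ℂ) =>
        if p ∈ Set.range e ∧ q ∈ Set.range e then x.2 else x.1)
      ((Measure.pi fun _ => L.fading).prod (Measure.pi fun _ => L.fading))
      (Measure.pi fun _ => L.fading) := by
    split_ifs
    exacts [measurePreserving_snd, measurePreserving_fst]
  have hlinks := measurePreserving_pi_prod _ _ fun p => measurePreserving_pi_prod _ _ (hlink p)
  convert! hlinks using 4
  exact extendLinks_comp ..

lemma measurePreserving_replaceLinks :
    MeasurePreserving (fun w : Fading K n × ChannelState K n => replaceLinks e w.1 w.2)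
      ((L.fadingLaw K n).prod (L.stateLaw K n)) (L.stateLaw K n) :=
  ((measurePreserving_extendLinks L e).prod (MeasurePreserving.id _)).comp
    (measurePreserving_prodAssoc _ _ _).symm

lemma exists_sum_replaceLinks_le {ι : Type*} [Fintype ι] {E : ι → Set (ChannelState K n)}
    (hE : ∀ i, MeasurableSet (E i)) :
    ∃ g, ∑ i, (L.stateLaw K n).real {s | replaceLinks e g s ∈ E i} ≤
      ∑ i, (L.stateLaw K n).real (E i) := by
  have hΨ := measurePreserving_replaceLinks (n := n) L e
  have hmeas (i) : Measurable fun g => L.stateLaw K n {s | replaceLinks e g s ∈ E i} :=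
    measurable_measure_prodMk_left (hΨ.measurable (hE i))
  have hlintegral (i) : ∫⁻ g, L.stateLaw K n {s | replaceLinks e g s ∈ E i} ∂L.fadingLaw K n =
      L.stateLaw K n (E i) := by
    rw [← hΨ.measure_preimage (hE i).nullMeasurableSet,
      Measure.prod_apply (hΨ.measurable (hE i))]
    rfl
  obtain ⟨g, hg⟩ := exists_le_lintegral (μ := L.fadingLaw K n)
    (Finset.measurable_fun_sum Finset.univ fun i _ => hmeas i).aemeasurable
  rw [lintegral_finsetSum _ fun i _ => hmeas i, Finset.sum_congr rfl fun i _ => hlintegral i] at hg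
  have hreal := ENNReal.toReal_mono (by simp [ENNReal.sum_eq_top]) hg
  rw [ENNReal.toReal_sum fun i _ => measure_ne_top _ _,
    ENNReal.toReal_sum fun i _ => measure_ne_top _ _] at hreal
  exact ⟨g, hreal⟩

end SubchannelLaw

section Restriction

variable {K M n : ℕ} {N : Fin K → ℕ}

/-- The users outside the range of `e`. -/
abbrev Others (e : Fin M ↪ Fin K) : Type := {q : Fin K // q ∉ Set.range e}

/-- The code for the users in the range of `e` obtained by fixing the messages `r` of the other
users and the coefficients `g` of the links that involve them. A receiver adds the interference
that the other users would have caused, which it can compute, to its signal. -/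
def Code.restrict (c : Code K n N) (U : Fin K → Fin K → Finset (Fin n)) (e : Fin M ↪ Fin K)
    (r : (q : Others e) → Fin (N q)) (g : Fading K n) : Code M n (fun p => N (e p)) where
  enc q m θ := c.enc (e q) m (extendLinks e θ (knownCSI U g))
  dec p y := c.dec (e p)
    (y.1 + ∑ q : Others e, g (e p) q * c.enc q (r q) (extendLinks e y.2.1 (knownCSI U g)),
      extendLinks e y.2.1 (knownCSI U g), y.2.2)
  enc_measurable q m := (c.enc_measurable (e q) m).comp (measurable_extendLinks _)
  dec_measurable p := by
    have hknown : Measurable fun y : (Fin n → ℂ) × Fading M n × Matrix (Fin n) (Fin n) ℂ =>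
        extendLinks e y.2.1 (knownCSI U g) :=
      (measurable_extendLinks _).comp (measurable_fst.comp measurable_snd)
    refine (c.dec_measurable (e p)).comp (Measurable.prodMk (measurable_fst.add ?_)
      (hknown.prodMk (measurable_snd.comp measurable_snd)))
    exact Finset.measurable_fun_sum _ fun q _ =>
      ((c.enc_measurable q (r q)).comp hknown).const_mul _

variable {c : Code K n N} {U : Fin K → Fin K → Finset (Fin n)} {e : Fin M ↪ Fin K}

lemma Code.HasPower.restrict {ρ : ℝ} (hpow : c.HasPower ρ) (r : (q : Others e) → Fin (N q))
    (g : Fading K n) : (c.restrict U e r g).HasPower ρ := by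
  intro m θ
  obtain ⟨m, hm⟩ := (splitEquiv e fun q => Fin (N q)).surjective (m, r)
  obtain ⟨rfl, -⟩ := Prod.ext_iff.1 hm
  refine le_trans ?_ (hpow m (extendLinks e θ (knownCSI U g)))
  rw [sum_eq_sum_comp_add_sum_compl e]
  exact le_add_of_nonneg_right (Finset.sum_nonneg fun _ _ => Finset.sum_nonneg fun _ _ =>
    sq_nonneg _)

lemma directMatrix_restrictState (g : Fading K n) (s : ChannelState K n) (p : Fin M) :
    directMatrix (restrictState e s).1 (restrictState e s).2.1 p =
      directMatrix (replaceLinks e g s).1 (replaceLinks e g s).2.1 (e p) := by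
  simp only [directMatrix, replaceLinks, extendLinks_apply]
  rfl

lemma received_replaceLinks (g : Fading K n) (s : ChannelState K n) (x : Fin K → Fin n → ℂ)
    (p : Fin M) :
    received (replaceLinks e g s) x (e p) =
      received (restrictState e s) (fun q => x (e q)) p + ∑ q : Others e, g (e p) q * x q := by
  funext j
  have hothers (q : Others e) : (replaceLinks e g s).1 (e p) q = g (e p) q :=
    extendLinks_of_notMem _ _ fun h => q.2 h.2
  simp only [received, directMatrix_restrictState g, Pi.add_apply, Finset.sum_apply, Pi.mul_apply,
    Finset.sum_erase_eq_sub (Finset.mem_univ _), sum_eq_sum_comp_add_sum_compl e, hothers]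
  simp only [replaceLinks, extendLinks_apply, restrictState]
  ring

lemma Code.preimage_errorEvent_restrict_subset (m : (q : Fin K) → Fin (N q)) (g : Fading K n) :
    restrictState e ⁻¹' (c.restrict U e (fun q => m q) g).errorEvent (fun p q => U (e p) (e q))
      (fun p => m (e p)) ⊆ {s | replaceLinks e g s ∈ c.errorEvent U m} := by
  rintro s ⟨p, hp⟩
  refine ⟨e p, fun h => hp (Eq.trans ?_ h)⟩
  rw [received_replaceLinks, ← directMatrix_restrictState, replaceLinks, knownCSI_extendLinks]
  simp only [Code.restrict]

lemma Code.errorEvent_restrict_le (L : ChannelLaw) (m : (q : Fin K) → Fin (N q))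
    (g : Fading K n) :
    ((L.comap e).stateLaw M n).real ((c.restrict U e (fun q => m q) g).errorEvent
        (fun p q => U (e p) (e q)) fun p => m (e p)) ≤
      (L.stateLaw K n).real {s | replaceLinks e g s ∈ c.errorEvent U m} := by
  rw [← (measurePreserving_restrictState L e).measureReal_preimage
    (Code.measurableSet_errorEvent _ _ _).nullMeasurableSet]
  exact measureReal_mono (Code.preimage_errorEvent_restrict_subset m g)

open scoped BigOperators in
lemma Code.errorProb_eq_expect (c : Code K n N) (L : ChannelLaw)
    (U : Fin K → Fin K → Finset (Fin n)) :
    c.errorProb L U = 𝔼 m, (L.stateLaw K n).real (c.errorEvent U m) := by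
  simp only [Code.errorProb, Fintype.expect_eq_sum_div_card, Fintype.card_pi, Fintype.card_fin,
    Nat.cast_prod]

/-- The fixed messages and coefficients are chosen so that the error is at most its average. -/
lemma Code.exists_restrict_errorProb_le (L : ChannelLaw) (c : Code K n N)
    (U : Fin K → Fin K → Finset (Fin n)) (e : Fin M ↪ Fin K) (hN : ∀ q, 0 < N q) :
    ∃ r g, (c.restrict U e r g).errorProb (L.comap e) (fun p q => U (e p) (e q)) ≤
      c.errorProb L U := by
  have (q : Fin K) : NeZero (N q) := ⟨(hN q).ne'⟩
  obtain ⟨g, hg⟩ := exists_sum_replaceLinks_le L e fun m => c.measurableSet_errorEvent U m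
  set split := splitEquiv e fun q => Fin (N q)
  set f := fun x => (L.stateLaw K n).real {s | replaceLinks e g s ∈ c.errorEvent U (split.symm x)}
  have hmean : Finset.univ.expect f ≤ c.errorProb L U := by
    rw [Code.errorProb_eq_expect, ← Fintype.expect_equiv split
      (fun m => (L.stateLaw K n).real {s | replaceLinks e g s ∈ c.errorEvent U m}) f fun m => by
        simp only [f, Equiv.symm_apply_apply]]
    simp only [Fintype.expect_eq_sum_div_card]
    gcongr
  rw [← Finset.univ_product_univ, Finset.expect_product, Finset.expect_comm] at hmean
  obtain ⟨r, -, hr⟩ := Finset.exists_le_of_expect_le Finset.univ_nonempty hmean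
  refine ⟨r, g, le_trans ?_ hr⟩
  rw [Code.errorProb_eq_expect]
  refine Finset.expect_le_expect fun m' _ => ?_
  obtain ⟨m, hm⟩ := split.surjective (m', r)
  obtain ⟨rfl, rfl⟩ := Prod.ext_iff.1 hm
  simp only [← hm, Equiv.symm_apply_apply]
  exact Code.errorEvent_restrict_le L m g

lemma ChannelLaw.IsAchievable.comap {L : ChannelLaw} {U : CSIPattern K} {ρ : ℝ}
    {R : Fin K → ℝ} (hR : L.IsAchievable U ρ R) (e : Fin M ↪ Fin K) :
    (L.comap e).IsAchievable (U.comap e) ρ fun p => R (e p) := by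
  refine ⟨fun p => hR.1 (e p), fun ε hε => (hR.2 ε hε).mono ?_⟩
  rintro n ⟨N, c, hN, hpow, herr⟩
  have hNpos (q) : 0 < N q :=
    Nat.cast_pos.1 ((Real.rpow_pos_of_pos two_pos _).trans_le (hN q))
  obtain ⟨r, g, hle⟩ := c.exists_restrict_errorProb_le L (U n) e hNpos
  exact ⟨_, c.restrict (U n) e r g, fun p => hN (e p), hpow.restrict r g, hle.trans herr⟩

lemma ChannelLaw.comap_mem_capacityRegion {L : ChannelLaw} {U : CSIPattern K} {ρ : ℝ}
    {R : Fin K → ℝ} (hR : R ∈ L.capacityRegion U ρ) (e : Fin M ↪ Fin K) :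
    (fun p => R (e p)) ∈ (L.comap e).capacityRegion (U.comap e) ρ :=
  map_mem_closure (f := fun (R : Fin K → ℝ) (p : Fin M) => R (e p)) (by fun_prop) hR
    fun _ hR => ChannelLaw.IsAchievable.comap hR e

lemma ChannelLaw.comap_mem_dofRegion {L : ChannelLaw} {U : CSIPattern K} {d : Fin K → ℝ}
    (hd : d ∈ L.dofRegion U) (e : Fin M ↪ Fin K) :
    (fun p => d (e p)) ∈ (L.comap e).dofRegion (U.comap e) := by
  refine ⟨fun p => hd.1 (e p), fun w hw => ?_⟩
  have hsum (x : Fin K → ℝ) : ∑ q, Function.extend e w 0 q * x q = ∑ p, w p * x (e p) := by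
    rw [sum_eq_sum_comp_add_sum_compl e, Finset.sum_eq_zero (s := Finset.univ (α := Others e))]
    · simp only [e.injective.extend_apply, add_zero]
    · intro q _
      rw [Function.extend_apply' _ _ _ q.2, Pi.zero_apply, zero_mul]
  have hw0 : 0 ≤ Function.extend e w 0 := Function.extend_nonneg hw le_rfl
  have hsup := hd.2 _ hw0
  simp only [hsum] at hsup
  refine hsup.trans (limsup_le_limsup (Eventually.of_forall fun ρ => iSup₂_le fun R hR => ?_))
  exact le_iSup₂_of_le (fun p => R (e p)) (comap_mem_capacityRegion hR e) le_rfl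

end Restriction

section Monotonicity

variable {K M : ℕ} {L : ChannelLaw}

lemma ChannelLaw.add_le_one_of_ne {U : CSIPattern K} {d : Fin K → ℝ} (hd : d ∈ L.dofRegion U)
    {p q : Fin K} (hpq : p ≠ q) : d p + d q ≤ 1 := by
  have hinj : Function.Injective ![p, q] := by
    intro i j hij
    fin_cases i <;> fin_cases j <;> simp_all
  simpa using (L.comap ⟨![p, q], hinj⟩).add_le_one_of_mem_dofRegion
    (ChannelLaw.comap_mem_dofRegion hd _)

lemma eq_half_of_sum_eq_card_div_two {ι : Type*} [Fintype ι] (hcard : 3 ≤ Fintype.card ι)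
    {d : ι → ℝ} (hpair : ∀ i j, i ≠ j → d i + d j ≤ 1) (hsum : ∑ i, d i = Fintype.card ι / 2)
    (i : ι) : d i = 1 / 2 := by
  classical
  have hcard' : (3 : ℝ) ≤ Fintype.card ι := by exact_mod_cast hcard
  have hle (i : ι) : d i ≤ 1 / 2 := by
    have hothers : ∑ j ∈ Finset.univ.erase i, (d i + d j) ≤ (Fintype.card ι : ℝ) - 1 := by
      refine (Finset.sum_le_card_nsmul _ _ 1 fun j hj =>
        hpair i j (Finset.ne_of_mem_erase hj).symm).trans_eq ?_
      rw [Finset.card_erase_of_mem (Finset.mem_univ i), Finset.card_univ, nsmul_one,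
        Nat.cast_pred (by lia)]
    rw [Finset.sum_add_distrib, Finset.sum_const, Finset.sum_erase_eq_sub (Finset.mem_univ i),
      hsum, Finset.card_erase_of_mem (Finset.mem_univ i), Finset.card_univ, nsmul_eq_mul,
      Nat.cast_pred (by lia)] at hothers
    nlinarith
  refine (Finset.sum_eq_sum_iff_of_le fun i _ => hle i).1 ?_ i (Finset.mem_univ i)
  rw [hsum, Finset.sum_const, Finset.card_univ, nsmul_eq_mul, mul_one_div]

/-- The pattern in which the coefficients of the links between two users in the range of `e` are
unknown as in `V`, and all the other coefficients are known. -/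
def CSIPattern.extend (V : CSIPattern M) (e : Fin M ↪ Fin K) : CSIPattern K :=
  fun n => extendLinks e (V n) fun _ _ => ∅

lemma CSIPattern.comap_extend (V : CSIPattern M) (e : Fin M ↪ Fin K) :
    (V.extend e).comap e = V := by
  funext n p q
  simp only [CSIPattern.comap, CSIPattern.extend, extendLinks_apply]

lemma perfectFraction_extend (V : CSIPattern M) (e : Fin M ↪ Fin K) :
    perfectFraction (V.extend e) = perfectFraction V := by
  have hslots (n : ℕ) (j : Fin n) : (∃ p q, p ≠ q ∧ j ∈ V.extend e n p q) ↔
      ∃ p q, p ≠ q ∧ j ∈ V n p q := by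
    constructor
    · rintro ⟨p, q, hpq, hj⟩
      by_cases h : p ∈ Set.range e ∧ q ∈ Set.range e
      · obtain ⟨⟨p, rfl⟩, q, rfl⟩ := h
        exact ⟨p, q, fun h => hpq (congrArg e h), by simpa [CSIPattern.extend] using hj⟩
      · rw [CSIPattern.extend, extendLinks_of_notMem _ _ h] at hj
        exact absurd hj (Finset.notMem_empty j)
    · rintro ⟨p, q, hpq, hj⟩
      exact ⟨e p, e q, e.injective.ne hpq, by simpa [CSIPattern.extend] using hj⟩
  funext n
  simp only [perfectFraction, hslots]

lemma ChannelLaw.AchievesMaxDoF.comap {U : CSIPattern K} (hU : L.AchievesMaxDoF U) (hK : 3 ≤ K)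
    (e : Fin M ↪ Fin K) : (L.comap e).AchievesMaxDoF (U.comap e) := by
  obtain ⟨d, hd, hsum⟩ := hU
  have hhalf := eq_half_of_sum_eq_card_div_two (by rwa [Fintype.card_fin])
    (fun p q hpq => ChannelLaw.add_le_one_of_ne hd hpq) (by rwa [Fintype.card_fin])
  refine ⟨_, ChannelLaw.comap_mem_dofRegion hd e, ?_⟩
  simp only [hhalf, Finset.sum_const, Finset.card_univ, Fintype.card_fin, nsmul_eq_mul,
    mul_one_div]

lemma ChannelLaw.sufficientFractions_subset (L : ChannelLaw) (hK : 3 ≤ K) (hMK : M ≤ K) :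
    L.sufficientFractions K ⊆ L.sufficientFractions M := by
  refine fun υ hυ => ⟨hυ.1, fun V hV => ?_⟩
  have hmax := hυ.2 (V.extend (Fin.castLEEmb hMK)) (by
    rwa [HasPerfectFraction, perfectFraction_extend])
  simpa only [CSIPattern.comap_extend, ChannelLaw.comap_castLEEmb] using
    hmax.comap hK (Fin.castLEEmb hMK)

lemma ChannelLaw.minCSIFraction_le_of_le (L : ChannelLaw) (hK : 3 ≤ K) (hMK : M ≤ K) :
    L.minCSIFraction M ≤ L.minCSIFraction K :=
  sInf_le_sInf (Set.image_mono (L.sufficientFractions_subset hK hMK))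

end Monotonicity

end InterferenceChannel

end

theorem theorem5 (L : InterferenceChannel.ChannelLaw) (K : ℕ) (hK : 3 ≤ K) :
    L.minCSIFraction K ≥ L.minCSIFraction (K - 1) :=
  L.minCSIFraction_le_of_le hK (K.sub_le 1)
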